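/- Let $\mathbb{k}$ be an algebraically closed field of prime characteristic $p$ and let $n$ be a natural number. For $\mathfrak g=\mathfrak{gl}_n(\mathbb{k})$ or $\mathfrak{sl}_n(\mathbb{k})$, with $p$-th power map $x\mapsto x^{[p]}$ given by the $p$-th power of matrices, and for $\chi\in\mathfrak g^*$, let $U_\chi(\mathfrak g)$ be the quotient of the universal enveloping algebra $U(\mathfrak g)$ by the two-sided ideal generated by all $x^p-x^{[p]}-\chi(x)^p$, $x\in\mathfrak g$. Let $\chi\in\mathfrak{gl}_n^*$, write $\chi$ also for its restriction to $\mathfrak{sl}_n$, and for a $U_\chi(\mathfrak{gl}_n)$-module $M$ let $\mathrm{res}_\chi M$ be $M$ regarded as a $U_\chi(\mathfrak{sl}_n)$-module through the homomorphism $U_\chi(\mathfrak{sl}_n)\to U_\chi(\mathfrak{gl}_n)$ induced by the inclusion $\mathfrak{sl}_n\subseteq\mathfrak{gl}_n$. Then: (1) If $M$ is a finite-dimensional indecomposable $U_\chi(\mathfrak{gl}_n)$-module, then $\mathrm{res}_\chi M$ is an indecomposable $U_\chi(\mathfrak{sl}_n)$-module. (2) If $P$ is an indecomposable projective $U_\chi(\mathfrak{gl}_n)$-module,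 then $\mathrm{res}_\chi P$ is an indecomposable projective $U_\chi(\mathfrak{sl}_n)$-module. (3) If $M$ is a simple $U_\chi(\mathfrak{gl}_n)$-module and $P_M$ is its projective cover, then there is a simple $U_\chi(\mathfrak{sl}_n)$-module $E$ such that $\mathrm{res}_\chi P_M$ is the projective cover of $E$. -/

import Mathlib

universe u v w

attribute [local instance 100] LieRing.ofAssociativeRing

section ReducedEnveloping

variable {k : Type u} [Field k] {L : Type v} [LieRing L] [LieAlgebra k L]

/-- The elements `x ^ p - x^[p] - χ(x) ^ p` of the universal enveloping algebra `U(L)`, set equal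
to `0`. Here `φ : L → L` is the `p`-th power map `x ↦ x^[p]`, and `χ` is the `p`-character. -/
inductive ReducedEnvelopingRel (p : ℕ) (φ : L → L) (χ : Module.Dual k L) :
    UniversalEnvelopingAlgebra k L → UniversalEnvelopingAlgebra k L → Prop
  | intro (x : L) : ReducedEnvelopingRel p φ χ
      (UniversalEnvelopingAlgebra.ι k x ^ p - UniversalEnvelopingAlgebra.ι k (φ x)
        - algebraMap k (UniversalEnvelopingAlgebra k L) (χ x ^ p)) 0

/-- The `χ`-reduced enveloping algebra: the quotient of `U(L)` by the two-sided ideal generated by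
all `x ^ p - x^[p] - χ(x) ^ p` with `x ∈ L`. -/
def ReducedEnvelopingAlgebra (p : ℕ) (φ : L → L) (χ : Module.Dual k L) : Type (max u v) :=
  RingQuot (ReducedEnvelopingRel p φ χ)

namespace ReducedEnvelopingAlgebra

variable (p : ℕ) (φ : L → L) (χ : Module.Dual k L)

noncomputable instance : Ring (ReducedEnvelopingAlgebra p φ χ) :=
  inferInstanceAs (Ring (RingQuot (ReducedEnvelopingRel p φ χ)))

noncomputable instance : Algebra k (ReducedEnvelopingAlgebra p φ χ) :=
  inferInstanceAs (Algebra k (RingQuot (ReducedEnvelopingRel p φ χ)))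

/-- The quotient map `U(L) → U_χ(L)`. -/
noncomputable def mk : UniversalEnvelopingAlgebra k L →ₐ[k] ReducedEnvelopingAlgebra p φ χ :=
  RingQuot.mkAlgHom k (ReducedEnvelopingRel p φ χ)

/-- The canonical map `L → U_χ(L)`. -/
noncomputable def ι : L →ₗ⁅k⁆ ReducedEnvelopingAlgebra p φ χ :=
  ((mk p φ χ : UniversalEnvelopingAlgebra k L →ₐ[k] ReducedEnvelopingAlgebra p φ χ) :
    UniversalEnvelopingAlgebra k L →ₗ⁅k⁆ ReducedEnvelopingAlgebra p φ χ).comp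
      (UniversalEnvelopingAlgebra.ι k)

theorem mk_ι (x : L) : mk p φ χ (UniversalEnvelopingAlgebra.ι k x) = ι p φ χ x := rfl

theorem ι_pow (x : L) : ι p φ χ x ^ p =
    ι p φ χ (φ x) + algebraMap k (ReducedEnvelopingAlgebra p φ χ) (χ x ^ p) := by
  have h : mk p φ χ (UniversalEnvelopingAlgebra.ι k x ^ p - UniversalEnvelopingAlgebra.ι k (φ x)
        - algebraMap k (UniversalEnvelopingAlgebra k L) (χ x ^ p)) = mk p φ χ 0 :=
    RingQuot.mkAlgHom_rel k (ReducedEnvelopingRel.intro x)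
  rw [map_sub, map_sub, map_pow, map_zero, AlgHom.commutes, mk_ι, mk_ι, sub_sub, sub_eq_zero] at h
  exact h

/-- The universal property of `U_χ(L)`. -/
noncomputable def lift {A : Type w} [Ring A] [Algebra k A] (f : L →ₗ⁅k⁆ A)
    (hf : ∀ x, f x ^ p = f (φ x) + algebraMap k A (χ x ^ p)) :
    ReducedEnvelopingAlgebra p φ χ →ₐ[k] A :=
  RingQuot.liftAlgHom k ⟨UniversalEnvelopingAlgebra.lift k f, by
    rintro _ _ ⟨x⟩
    rw [map_sub, map_sub, map_pow, map_zero, AlgHom.commutes,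
      UniversalEnvelopingAlgebra.lift_ι_apply, UniversalEnvelopingAlgebra.lift_ι_apply, hf x]
    abel⟩

theorem lift_ι {A : Type w} [Ring A] [Algebra k A] (f : L →ₗ⁅k⁆ A)
    (hf : ∀ x, f x ^ p = f (φ x) + algebraMap k A (χ x ^ p)) (x : L) :
    lift p φ χ f hf (ι p φ χ x) = f x := by
  have h : lift p φ χ f hf (mk p φ χ (UniversalEnvelopingAlgebra.ι k x)) =
      UniversalEnvelopingAlgebra.lift k f (UniversalEnvelopingAlgebra.ι k x) :=
    RingQuot.liftAlgHom_mkAlgHom_apply k _ _ _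
  rw [UniversalEnvelopingAlgebra.lift_ι_apply] at h
  exact h

end ReducedEnvelopingAlgebra

end ReducedEnveloping

section GlSl

variable {k : Type u} [Field k] (p : ℕ) [Fact p.Prime] [CharP k p] (n : ℕ)

/-- `U_χ(gl_n)`; the `p`-th power map of `gl_n` is the `p`-th power of matrices. -/
abbrev UGl (χ : Module.Dual k (Matrix (Fin n) (Fin n) k)) : Type u :=
  ReducedEnvelopingAlgebra p (fun x : Matrix (Fin n) (Fin n) k => x ^ p) χ

theorem matrix_trace_pow_char (M : Matrix (Fin n) (Fin n) k) :
    Matrix.trace (M ^ p) = Matrix.trace M ^ p := by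
  cases isEmpty_or_nonempty (Fin n)
  · simp [Matrix.trace, (Fact.out : p.Prime).ne_zero]
  have hp : 0 < p := (Fact.out : p.Prime).pos
  have h : M.charpoly ^ p = Polynomial.expand k p (M ^ p).charpoly := by
    unfold Matrix.charpoly
    rw [AlgHom.map_det, ← Matrix.coe_detMonoidHom, ← map_pow]
    apply congr_arg Matrix.det
    refine matPolyEquiv.injective ?_
    rw [map_pow, Matrix.matPolyEquiv_charmatrix,
      sub_pow_char_of_commute p (Polynomial.commute_X (Polynomial.C M)), ← Polynomial.C_pow]
    have h1 := matPolyEquiv_eq_X_pow_sub_C p M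
    exact h1.symm
  have hc := congr_arg (fun q => Polynomial.coeff q ((Fintype.card (Fin n) - 1) * p)) h
  simp only [← Polynomial.map_frobenius_expand p, Polynomial.coeff_map,
    Polynomial.coeff_expand_mul hp] at hc
  rw [frobenius_def] at hc
  have e1 := Matrix.trace_eq_neg_charpoly_coeff M
  have e2 := Matrix.trace_eq_neg_charpoly_coeff (M ^ p)
  have e3 : (-(Matrix.trace M)) ^ p = -(Matrix.trace M ^ p) := by
    have := map_neg (frobenius k p) (Matrix.trace M)
    simpa only [frobenius_def] using this
  rw [e2, ← hc, ← neg_eq_iff_eq_neg.mpr e1, e3, neg_neg]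

/-- The `p`-th power map of `sl_n`, the restriction of the one of `gl_n`. -/
def slPow (x : LieAlgebra.SpecialLinear.sl (Fin n) k) : LieAlgebra.SpecialLinear.sl (Fin n) k :=
  ⟨x.1 ^ p, by
    have hx : Matrix.trace x.1 = 0 := x.2
    change Matrix.trace (x.1 ^ p) = 0
    rw [matrix_trace_pow_char, hx, zero_pow (Fact.out : p.Prime).ne_zero]⟩

/-- `U_χ(sl_n)`. -/
abbrev USl (χ : Module.Dual k (LieAlgebra.SpecialLinear.sl (Fin n) k)) : Type u :=
  ReducedEnvelopingAlgebra p (slPow p n) χ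

/-- The restriction of `χ ∈ gl_n^*` to `sl_n`. -/
def resChar (χ : Module.Dual k (Matrix (Fin n) (Fin n) k)) :
    Module.Dual k (LieAlgebra.SpecialLinear.sl (Fin n) k) :=
  χ ∘ₗ (LieAlgebra.SpecialLinear.sl (Fin n) k).toSubmodule.subtype

/-- The algebra map `U_χ(sl_n) → U_χ(gl_n)` induced by the inclusion `sl_n ⊆ gl_n`. -/
noncomputable def slToGl (χ : Module.Dual k (Matrix (Fin n) (Fin n) k)) :
    USl p n (resChar n χ) →ₐ[k] UGl p n χ :=
  ReducedEnvelopingAlgebra.lift p (slPow p n) (resChar n χ)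
    ((ReducedEnvelopingAlgebra.ι p (fun x : Matrix (Fin n) (Fin n) k => x ^ p) χ).comp
      (LieAlgebra.SpecialLinear.sl (Fin n) k).incl)
    (by
      intro x
      exact ReducedEnvelopingAlgebra.ι_pow p (fun x : Matrix (Fin n) (Fin n) k => x ^ p) χ x.1)

theorem slToGl_ι (χ : Module.Dual k (Matrix (Fin n) (Fin n) k))
    (x : LieAlgebra.SpecialLinear.sl (Fin n) k) :
    slToGl p n χ (ReducedEnvelopingAlgebra.ι p (slPow p n) (resChar n χ) x) =
      ReducedEnvelopingAlgebra.ι p (fun y : Matrix (Fin n) (Fin n) k => y ^ p) χ x.1 :=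
  ReducedEnvelopingAlgebra.lift_ι p (slPow p n) (resChar n χ) _ _ x

/-- The restriction functor on objects: the abelian group `M` with `U_χ(sl_n)` acting through
`U_χ(sl_n) → U_χ(gl_n)`. -/
def Res (_χ : Module.Dual k (Matrix (Fin n) (Fin n) k)) (M : Type v) : Type v := M

variable (χ : Module.Dual k (Matrix (Fin n) (Fin n) k)) (M : Type v) [AddCommGroup M]

instance : AddCommGroup (Res n χ M) := inferInstanceAs (AddCommGroup M)

noncomputable instance [Module (UGl p n χ) M] :
    Module (USl p n (resChar n χ)) (Res n χ M) :=
  Module.compHom M (slToGl p n χ : USl p n (resChar n χ) →+* UGl p n χ)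

end GlSl

section Modules

variable (A : Type u) [Ring A] (M : Type v) [AddCommGroup M] [Module A M]

/-- A module is indecomposable if it is nonzero and is not the direct sum of two nonzero
submodules. -/
def IsIndecomposable : Prop :=
  Nontrivial M ∧ ∀ N₁ N₂ : Submodule A M, IsCompl N₁ N₂ → N₁ = ⊥ ∨ N₂ = ⊥

variable {A M}

/-- `π : P → M` is a projective cover: `P` is projective, and `π` is surjective with superfluous
kernel. -/
structure IsProjectiveCover {P : Type w} [AddCommGroup P] [Module A P] (π : P →ₗ[A] M) : Prop where
  projective : Module.Projective A P
  surjective : Function.Surjective π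
  superfluous : ∀ N : Submodule A P, N ⊔ LinearMap.ker π = ⊤ → N = ⊤

end Modules

/-! Write gl_n = sl_n + kE with E = E_11 toral (for n = 0 take E = 0).

(1) On a module M the operator d of E satisfies d^p = d + χ(E)^p. Let C be the algebra of
sl_n-endomorphisms of M. Since sl_n is an ideal, ad d acts on C, and (ad d)^p = ad d, so C is graded
by weights and its weight zero part is End_{gl_n}(M), which is local by Fitting's lemma. A
decomposition of res M is an idempotent e in C; put f = 1 - e. Decomposing e and f into generalized
eigenvectors of twisted derivations shows that the weight zero part of each is a sum of
non-invertible maps whenever e and f both differ from 1. Locality then makes 1 = e + f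
non-invertible, a contradiction (`idempotent_eq_zero_or_one`).

(2) U_χ is finite-dimensional, so an indecomposable projective P is finitely generated
(`IsIndecomposable.finite_of_projective`) and (1) applies to it. Restriction preserves projectives
because it has an exact right adjoint. That adjoint is built by hand, without a PBW basis: on
functions ZMod p → N, let sl_n act through its grading by ad E, and let E act on the j-th copy of N
as μ + j, where μ^p = μ + χ(E)^p. A weak Jacobson formula reduces χ-reducedness to homogeneous
elements (`coindGl_pow_char`). Given a surjection N → res P, lifting the weight decomposition of P
to this module and summing over j splits it (`exists_section_of_projective`).

(3) The projective cover of a simple module is indecomposable, so its restriction is indecomposable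
projective of finite length; such a module covers its quotient by any maximal submodule. -/

section Fitting

/-! ### Fitting's lemma and local endomorphism rings. -/

variable {A : Type u} [Ring A] {M : Type v} [AddCommGroup M] [Module A M]

theorem IsIndecomposable.isUnit_or_isNilpotent [IsNoetherian A M] [IsArtinian A M]
    (h : IsIndecomposable A M) (r : Module.End A M) : IsUnit r ∨ IsNilpotent r := by
  obtain ⟨m, hm⟩ := Filter.eventually_atTop.mp r.eventually_isCompl_ker_pow_range_pow
  -- A positive exponent is needed: the kernel of `r ^ 0` says nothing about `r`.
  have hc := hm (m + 1) (Nat.le_succ m)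
  rcases h.2 _ _ hc with hk | hr
  · left
    rw [Module.End.isUnit_iff]
    have hi : Function.Injective r := by
      rw [← LinearMap.ker_eq_bot, eq_bot_iff, ← hk]
      intro x hx
      rw [LinearMap.mem_ker] at hx ⊢
      rw [pow_succ, Module.End.mul_apply, hx, map_zero]
    exact IsArtinian.bijective_of_injective_endomorphism r hi
  · right
    exact ⟨m + 1, LinearMap.range_eq_bot.mp hr⟩

theorem IsIndecomposable.isLocalRing_end [IsNoetherian A M] [IsArtinian A M]
    (h : IsIndecomposable A M) : IsLocalRing (Module.End A M) := by
  have := h.1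
  refine IsLocalRing.of_isUnit_or_isUnit_of_isUnit_add fun a b hab => ?_
  obtain ⟨w, hw⟩ := hab
  have h1 : a * ↑w⁻¹ = 1 - b * ↑w⁻¹ := by
    rw [eq_sub_iff_add_eq, ← add_mul, ← hw, Units.mul_inv]
  rcases h.isUnit_or_isNilpotent (b * ↑w⁻¹) with hb | hb
  · exact Or.inr ((Units.isUnit_mul_units b w⁻¹).mp hb)
  · left
    rw [← Units.isUnit_mul_units a w⁻¹, h1]
    exact hb.isUnit_one_sub

end Fitting

/-! ### Twisted derivations and their generalized eigenvectors. -/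

section WeightArgument

variable {k : Type u} [Field k] {p : ℕ} [Fact p.Prime] [CharP k p]
  {A : Type v} [Ring A] [Algebra k A]

/-- The twisted derivation `r ↦ a * r - r * b`. -/
def twistedAd (k : Type u) [Field k] {A : Type v} [Ring A] [Algebra k A] (a b : A) :
    Module.End k A :=
  LinearMap.mulLeft k a - LinearMap.mulRight k b

theorem twistedAd_apply (a b r : A) : twistedAd k a b r = a * r - r * b := rfl

include p in
theorem twistedAd_pow_char_pow (a b : A) (m : ℕ) :
    twistedAd k a b ^ p ^ m = twistedAd k (a ^ p ^ m) (b ^ p ^ m) := by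
  have : CharP (Module.End k A) p ∨ Subsingleton A := by
    rcases subsingleton_or_nontrivial A with h | h
    · exact Or.inr h
    · exact Or.inl (charP_of_injective_algebraMap
        (FaithfulSMul.algebraMap_injective k (Module.End k A)) p)
  rcases this with h | h
  · rw [twistedAd, sub_pow_char_pow_of_commute p _ (LinearMap.commute_mulLeft_right a b),
      LinearMap.pow_mulLeft, LinearMap.pow_mulRight, twistedAd]
  · exact LinearMap.ext fun x => Subsingleton.elim _ _

theorem twistedAd_sub_algebraMap_mul (a b c r s : A) (μ ν : k) :
    (twistedAd k a c - algebraMap k _ (μ + ν)) (r * s) =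
      (twistedAd k a b - algebraMap k _ μ) r * s + r * (twistedAd k b c - algebraMap k _ ν) s := by
  simp only [LinearMap.sub_apply, twistedAd_apply, Module.algebraMap_end_apply, sub_mul, mul_sub,
    add_smul, smul_mul_assoc, mul_smul_comm, mul_assoc]
  abel

/-- The Leibniz rule `twistedAd_sub_algebraMap_mul` makes generalized eigenvalues add under
products; each application of the rule lowers either i or j by one. -/
theorem twistedAd_pow_mul_eq_zero (a b c : A) (μ ν : k) (i j : ℕ) (r s : A)
    (hr : ((twistedAd k a b - algebraMap k _ μ) ^ i) r = 0)
    (hs : ((twistedAd k b c - algebraMap k _ ν) ^ j) s = 0) :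
    ((twistedAd k a c - algebraMap k _ (μ + ν)) ^ (i + j)) (r * s) = 0 := by
  induction hn : i + j generalizing i j r s with
  | zero =>
    obtain ⟨rfl, rfl⟩ : i = 0 ∧ j = 0 := by omega
    have : r = 0 := by simpa using hr
    simp [this]
  | succ n ih =>
    rw [pow_succ, Module.End.mul_apply, twistedAd_sub_algebraMap_mul a b, map_add]
    have h1 : ((twistedAd k a c - algebraMap k _ (μ + ν)) ^ n)
        ((twistedAd k a b - algebraMap k _ μ) r * s) = 0 := by
      cases i with
      | zero =>
        have : r = 0 := by simpa using hr
        simp [this]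
      | succ i =>
        exact ih i j _ s (by rw [← Module.End.mul_apply, ← pow_succ, hr]) hs (by omega)
    have h2 : ((twistedAd k a c - algebraMap k _ (μ + ν)) ^ n)
        (r * (twistedAd k b c - algebraMap k _ ν) s) = 0 := by
      cases j with
      | zero =>
        have : s = 0 := by simpa using hs
        simp [this]
      | succ j =>
        exact ih i j r _ hr (by rw [← Module.End.mul_apply, ← pow_succ, hs]) (by omega)
    rw [h1, h2, add_zero]

include p in
/-- If `d ^ p = d + c`, then `ad d` acts as a scalar on its generalized eigenvectors. -/
theorem exists_twistedAd_eq_smul {d : A} {c : k} (hd : d ^ p = d + algebraMap k A c) (ρ : k)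
    (n : ℕ) (r : A) (hr : ((twistedAd k d d - algebraMap k _ ρ) ^ n) r = 0) :
    ∃ σ : k, twistedAd k d d r = σ • r := by
  rcases subsingleton_or_nontrivial A with h | h
  · exact ⟨0, Subsingleton.elim _ _⟩
  have : CharP (Module.End k A) p := charP_of_injective_algebraMap
        (FaithfulSMul.algebraMap_injective k (Module.End k A)) p
  have h1 : twistedAd k d d ^ p = twistedAd k d d := by
    have := twistedAd_pow_char_pow (k := k) (p := p) d d 1
    rw [pow_one] at this
    rw [this, hd]
    ext x
    simp only [twistedAd_apply, add_mul, mul_add, Algebra.commutes]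
    abel
  have h2 : ∀ m : ℕ, twistedAd k d d ^ p ^ m = twistedAd k d d := by
    intro m
    induction m with
    | zero => simp
    | succ m ih => rw [pow_succ, pow_mul, ih, h1]
  have hp := (Fact.out : p.Prime).one_lt
  have hn : n ≤ p ^ n := (Nat.lt_pow_self hp).le
  -- With D = ad d and D^p = D, raising D - ρ to the power p^n ≥ n gives D - ρ^(p^n), which
  -- therefore kills r.
  refine ⟨ρ ^ p ^ n, ?_⟩
  have h3 : ((twistedAd k d d - algebraMap k _ ρ) ^ p ^ n) r = 0 := by
    rw [← Nat.sub_add_cancel hn, pow_add, Module.End.mul_apply, hr, map_zero]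
  rw [sub_pow_char_pow_of_commute p _ (Algebra.commute_algebraMap_right _ _), h2, ← map_pow,
    LinearMap.sub_apply, Module.algebraMap_end_apply, sub_eq_zero] at h3
  exact h3

end WeightArgument

/-! ### Idempotents of a graded endomorphism algebra with local weight zero part. -/

section IdempotentArgument

variable {k : Type u} [Field k] {p : ℕ} [Fact p.Prime] [CharP k p]
  {A : Type w} [Ring A] {V : Type v} [AddCommGroup V] [Module k V] [Module A V]

/-- `z` agrees with a non-invertible `A`-linear endomorphism. -/
def IsLinearNonunit (A : Type w) [Ring A] {V : Type v} [AddCommGroup V] [Module k V] [Module A V]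
    (z : Module.End k V) : Prop :=
  ∃ z' : Module.End A V, (∀ v, z' v = z v) ∧ z' ∈ nonunits (Module.End A V)

theorem IsLinearNonunit.add [IsLocalRing (Module.End A V)] {x y : Module.End k V}
    (hx : IsLinearNonunit A x) (hy : IsLinearNonunit A y) : IsLinearNonunit A (x + y) := by
  obtain ⟨x', hx1, hx2⟩ := hx
  obtain ⟨y', hy1, hy2⟩ := hy
  exact ⟨x' + y', fun v => by simp [hx1, hy1], IsLocalRing.nonunits_add hx2 hy2⟩

theorem IsLinearNonunit.zero [IsLocalRing (Module.End A V)] :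
    IsLinearNonunit A (0 : Module.End k V) :=
  ⟨0, fun v => by simp, by simp⟩

theorem not_isLinearNonunit_one : ¬ IsLinearNonunit A (1 : Module.End k V) := by
  rintro ⟨z, hz, hn⟩
  have : z = 1 := LinearMap.ext fun v => by simp [hz]
  exact hn (this ▸ isUnit_one)

variable {S : Set (Module.End k V)} {d : Module.End k V} {c : k}

/-- The projection onto the weight zero part of `ad d`, when `(ad d) ^ p = ad d`. -/
noncomputable def weightZeroProj (p : ℕ) (d : Module.End k V) : Module.End k (Module.End k V) :=
  1 - twistedAd k d d ^ (p - 1)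

omit [CharP k p] in
theorem weightZeroProj_one : weightZeroProj p d 1 = 1 := by
  have : p - 1 ≠ 0 := by have := (Fact.out : p.Prime).two_le; omega
  obtain ⟨m, hm⟩ := Nat.exists_eq_succ_of_ne_zero this
  rw [weightZeroProj, LinearMap.sub_apply, hm, pow_succ, Module.End.mul_apply, twistedAd_apply]
  simp

/-- The commutator of t r - r t' with s is [t,s] r - r [t',s] = [d,s] r - r [d,s], and this vanishes
since [d,s] is in S. Only the brackets of t and t' with S matter, so d may be replaced by its
block-diagonal part. -/
theorem twistedAd_mem_centralizer (hS : ∀ s ∈ S, d * s - s * d ∈ S) {t t' r : Module.End k V}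
    (ht : ∀ s ∈ S, t * s - s * t = d * s - s * d)
    (ht' : ∀ s ∈ S, t' * s - s * t' = d * s - s * d)
    (hr : ∀ s ∈ S, Commute r s) : ∀ s ∈ S, Commute (twistedAd k t t' r) s := by
  intro s hs
  rw [Commute, SemiconjBy, twistedAd_apply, ← sub_eq_zero]
  have h1 := ht s hs
  have h2 := ht' s hs
  have h3 := (hr s hs).eq
  have h4 := (hr _ (hS s hs)).eq
  have : (t * r - r * t') * s - s * (t * r - r * t') =
      (t * s - s * t) * r - r * (t' * s - s * t') := by
    simp only [sub_mul, mul_sub, mul_assoc, h3]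
    rw [← mul_assoc r s t', h3]
    simp only [mul_assoc]
    abel
  rw [this, h1, h2, h4, sub_self]

/-- The product r s is a genuine eigenvector of ad d, so its weight zero part is a scalar multiple
of r s. If that were invertible, r would be surjective, hence injective by finite dimension, and r e
= r would force e = 1. -/
theorem isLinearNonunit_weightZeroProj_mul [Module.Finite k V]
    (hA : ∀ r : Module.End k V, (∀ s ∈ S, Commute r s) → Commute r d →
      ∃ r' : Module.End A V, ∀ v, r' v = r v)
    (hd : d ^ p = d + algebraMap k _ c) {t e r s : Module.End k V} (he : e ≠ 1) (hre : r * e = r)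
    (hr : ∀ x ∈ S, Commute r x) (hs : ∀ x ∈ S, Commute s x) {μ ν : k} {i j : ℕ}
    (hrm : ((twistedAd k d t - algebraMap k _ μ) ^ i) r = 0)
    (hsm : ((twistedAd k t d - algebraMap k _ ν) ^ j) s = 0) :
    IsLinearNonunit A (weightZeroProj p d (r * s)) := by
  have h0 := twistedAd_pow_mul_eq_zero d t d μ ν i j r s hrm hsm
  obtain ⟨σ, hσ⟩ := exists_twistedAd_eq_smul hd _ _ _ h0
  have hpow : ∀ m : ℕ, (twistedAd k d d ^ m) (r * s) = σ ^ m • (r * s) := by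
    intro m
    induction m with
    | zero => simp
    | succ m ih => rw [pow_succ', Module.End.mul_apply, ih, map_smul, hσ, smul_smul, pow_succ]
  have hz : weightZeroProj p d (r * s) = (1 - σ ^ (p - 1)) • (r * s) := by
    rw [weightZeroProj, LinearMap.sub_apply, hpow, sub_smul, one_smul, Module.End.one_apply]
  -- With D = ad d, D(1 - D^(p-1)) = D - D^p = 0.
  have hcd : Commute (weightZeroProj p d (r * s)) d := by
    have h1 := twistedAd_pow_char_pow (k := k) (p := p) d d 1
    have h2 : twistedAd k d d (weightZeroProj p d (r * s)) = 0 := by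
      have hp : p - 1 + 1 = p := Nat.sub_add_cancel (Fact.out : p.Prime).one_lt.le
      rw [weightZeroProj, LinearMap.sub_apply, map_sub, ← Module.End.mul_apply _ (_ ^ _),
        ← pow_succ', hp, ← pow_one p, h1, pow_one, hd, Module.End.one_apply]
      simp only [twistedAd_apply, add_mul, mul_add, Algebra.commutes]
      abel
    rw [twistedAd_apply, sub_eq_zero] at h2
    exact h2.symm
  have hcs : ∀ x ∈ S, Commute (weightZeroProj p d (r * s)) x := by
    intro x hx
    rw [hz]
    exact ((hr x hx).mul_left (hs x hx)).smul_left _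
  obtain ⟨z', hz'⟩ := hA _ hcs hcd
  refine ⟨z', hz', fun hu => he ?_⟩
  have hb := (Module.End.isUnit_iff _).mp hu
  have hsurj : Function.Surjective r := by
    intro v
    obtain ⟨w, hw⟩ := hb.2 v
    refine ⟨(1 - σ ^ (p - 1)) • s w, ?_⟩
    rw [← hw, hz', hz, map_smul]
    rfl
  have hinj : Function.Injective r := LinearMap.injective_iff_surjective.mpr hsurj
  ext v
  apply hinj
  rw [← Module.End.mul_apply, hre, Module.End.one_apply]

/-- If the `A`-linear maps are those commuting with `S` and `d`, where `ad d` preserves `S` and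
`d ^ p - d` is a scalar, then `V` has no nontrivial idempotents commuting with `S` as soon as its
`A`-linear endomorphisms form a local ring. -/
theorem idempotent_eq_zero_or_one [IsAlgClosed k] [Module.Finite k V]
    [IsLocalRing (Module.End A V)]
    (hA : ∀ r : Module.End k V, (∀ s ∈ S, Commute r s) → Commute r d →
      ∃ r' : Module.End A V, ∀ v, r' v = r v)
    (hd : d ^ p = d + algebraMap k _ c) (hS : ∀ s ∈ S, d * s - s * d ∈ S)
    {e : Module.End k V} (hee : e * e = e) (he : ∀ s ∈ S, Commute e s) : e = 0 ∨ e = 1 := by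
  by_contra! hcon
  obtain ⟨hne0, hne1⟩ := hcon
  set f : Module.End k V := 1 - e with hf
  have hfe : f * e = 0 := by rw [hf, sub_mul, one_mul, hee, sub_self]
  have hef : e * f = 0 := by rw [hf, mul_sub, mul_one, hee, sub_self]
  have hff : f * f = f := by rw [hf, mul_sub, ← hf, hfe, mul_one, sub_zero]
  have hfs : ∀ s ∈ S, Commute f s := fun s hs => (Commute.one_left s).sub_left (he s hs)
  have hadd : e + f = 1 := by rw [hf]; abel
  -- The block-diagonal part of d: it has the same brackets with S as d, but commutes with e and f.
  -- No relation t^p = t + c is available, so only generalized eigenvectors can be used below.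
  set t : Module.End k V := e * d * e + f * d * f with ht
  have hte : Commute t e := by
    rw [Commute, SemiconjBy, ht, add_mul, mul_add, mul_assoc, hee, mul_assoc (f * d), hfe,
      ← mul_assoc e (e * d), ← mul_assoc e e, hee, ← mul_assoc e (f * d), ← mul_assoc e f, hef]
    simp
  have htf : Commute t f := (Commute.one_right t).sub_right hte
  have hts : ∀ s ∈ S, t * s - s * t = d * s - s * d := by
    intro s hs
    have h1 := (he s hs).eq
    have h2 := (hfs s hs).eq
    have h3 := (he _ (hS s hs)).eq
    have h4 := (hfs _ (hS s hs)).eq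
    have : t * s - s * t = e * (d * s - s * d) * e + f * (d * s - s * d) * f := by
      have a1 : e * d * e * s = e * (d * s) * e := by
        rw [mul_assoc _ e, h1]; simp only [mul_assoc]
      have a2 : f * d * f * s = f * (d * s) * f := by
        rw [mul_assoc _ f, h2]; simp only [mul_assoc]
      have a3 : s * (e * d * e) = e * (s * d) * e := by
        rw [← mul_assoc, ← mul_assoc, ← h1]; simp only [mul_assoc]
      have a4 : s * (f * d * f) = f * (s * d) * f := by
        rw [← mul_assoc, ← mul_assoc, ← h2]; simp only [mul_assoc]
      rw [ht, add_mul, mul_add, a1, a2, a3, a4]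
      simp only [mul_sub, sub_mul]
      abel
    rw [this, h3, h4, mul_assoc, hee, mul_assoc, hff, ← mul_add, hadd, mul_one]
  have key : ∀ g : Module.End k V, g * g = g → (∀ s ∈ S, Commute g s) → Commute t g → g ≠ 1 →
      IsLinearNonunit A (weightZeroProj p d (g * g)) := by
    intro g hgg hgs htg hg1
    -- X is stable under r ↦ d r - r t because t commutes with g, so the eigencomponents of the left
    -- factor g still satisfy r g = r. For the right factor the whole centralizer Y suffices. Then g
    -- = g g expands into products of eigenvectors.
    let X : Submodule k (Module.End k V) :=
      { carrier := {r | (∀ s ∈ S, Commute r s) ∧ r * g = r}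
        add_mem' := fun {a b} ha hb => ⟨fun s hs => (ha.1 s hs).add_left (hb.1 s hs), by
          rw [add_mul, ha.2, hb.2]⟩
        zero_mem' := ⟨fun s _ => Commute.zero_left s, zero_mul _⟩
        smul_mem' := fun κ a ha => ⟨fun s hs => (ha.1 s hs).smul_left κ, by
          rw [smul_mul_assoc, ha.2]⟩ }
    let Y : Submodule k (Module.End k V) :=
      { carrier := {r | ∀ s ∈ S, Commute r s}
        add_mem' := fun {a b} ha hb s hs => (ha s hs).add_left (hb s hs)
        zero_mem' := fun s _ => Commute.zero_left s
        smul_mem' := fun κ a ha s hs => (ha s hs).smul_left κ }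
    have hX : ∀ r ∈ X, twistedAd k d t r ∈ X := fun r hr =>
      ⟨twistedAd_mem_centralizer hS (fun _ _ => rfl) hts hr.1, by
        rw [twistedAd_apply, sub_mul, mul_assoc, hr.2, mul_assoc, htg.eq, ← mul_assoc, hr.2]⟩
    have hY : ∀ r ∈ Y, twistedAd k t d r ∈ Y := fun r hr =>
      twistedAd_mem_centralizer hS hts (fun _ _ => rfl) hr
    have eX := Submodule.eq_iSup_inf_genEigenspace ⊤ hX
      (Module.End.iSup_maxGenEigenspace_eq_top (twistedAd k d t))
    have eY := Submodule.eq_iSup_inf_genEigenspace ⊤ hY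
      (Module.End.iSup_maxGenEigenspace_eq_top (twistedAd k t d))
    have hgX : g ∈ ⨆ μ, X ⊓ (twistedAd k d t).genEigenspace μ ⊤ := by
      rw [← eX]; exact ⟨hgs, hgg⟩
    have hgY : g ∈ ⨆ μ, Y ⊓ (twistedAd k t d).genEigenspace μ ⊤ := by
      rw [← eY]; exact hgs
    have main : ∀ r ∈ ⨆ μ, X ⊓ (twistedAd k d t).genEigenspace μ ⊤,
        ∀ s ∈ ⨆ μ, Y ⊓ (twistedAd k t d).genEigenspace μ ⊤,
          IsLinearNonunit A (weightZeroProj p d (r * s)) := by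
      intro r hr s hs
      induction hr using Submodule.iSup_induction' with
      | mem μ r hr =>
        induction hs using Submodule.iSup_induction' with
        | mem ν s hs =>
          obtain ⟨i, hi⟩ := (Module.End.mem_maxGenEigenspace _ _ _).mp hr.2
          obtain ⟨j, hj⟩ := (Module.End.mem_maxGenEigenspace _ _ _).mp hs.2
          refine isLinearNonunit_weightZeroProj_mul (t := t) hA hd hg1 hr.1.2 hr.1.1 hs.1
            (μ := μ) (ν := ν) (i := i) (j := j) ?_ ?_
          · simpa [Algebra.algebraMap_eq_smul_one] using hi
          · simpa [Algebra.algebraMap_eq_smul_one] using hj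
        | zero => rw [mul_zero, map_zero]; exact IsLinearNonunit.zero
        | add s s' _ _ h h' => rw [mul_add, map_add]; exact h.add h'
      | zero => rw [zero_mul, map_zero]; exact IsLinearNonunit.zero
      | add s s' _ _ h h' => rw [add_mul, map_add]; exact h.add h'
    exact main g hgX g hgY
  -- Non-units of the local ring are closed under addition, so the weight zero part of e + f = 1,
  -- which is 1 itself, would be a non-unit.
  have h1 := (key e hee he hte hne1).add (key f hff hfs htf fun h => hne0 (by
    rw [hf] at h
    simpa using h))
  rw [← map_add, hee, hff, hadd, weightZeroProj_one] at h1
  exact not_isLinearNonunit_one h1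

end IdempotentArgument

/-! ### Finite-dimensionality by rewriting words. -/

section Finiteness

variable {k : Type u} [Field k] {A : Type v} [Ring A] [Algebra k A] {κ : Type w}
  {y : κ → A} {V : Submodule k A} {p : ℕ}

theorem list_prod_mem_pow (hy : ∀ i, y i ∈ V) (l : List κ) :
    (l.map y).prod ∈ V ^ l.length := by
  induction l with
  | nil => simpa using Submodule.one_le.mp (le_of_eq (pow_zero V).symm)
  | cons a l ih =>
    rw [List.map_cons, List.prod_cons, List.length_cons, pow_succ']
    exact Submodule.mul_mem_mul (hy a) ih

/-- Swapping adjacent letters changes a word by a commutator, which lies in V and so replaces two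
letters by one. -/
theorem list_perm_prod_sub_prod_mem (h1 : 1 ∈ V) (hy : ∀ i, y i ∈ V)
    (hc : ∀ i j, y i * y j - y j * y i ∈ V) {l l' : List κ} (h : l.Perm l') :
    (l.map y).prod - (l'.map y).prod ∈ V ^ (l.length - 1) := by
  have hV : (1 : Submodule k A) ≤ V := Submodule.one_le.mpr h1
  induction h with
  | nil => simp
  | cons a h ih =>
    rename_i l l'
    rw [List.map_cons, List.prod_cons, List.map_cons, List.prod_cons, ← mul_sub, List.length_cons,
      Nat.add_sub_cancel]
    -- For empty l the truncated `l.length - 1` breaks the exponent count, but then the two words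
    -- coincide.
    rcases Nat.eq_zero_or_pos l.length with h0 | h0
    · obtain rfl := List.length_eq_zero_iff.mp h0
      obtain rfl := h.nil_eq
      simp
    · rw [← Nat.sub_add_cancel h0, pow_succ']
      exact Submodule.mul_mem_mul (hy a) ih
  | swap a b l =>
    simp only [List.map_cons, List.prod_cons, List.length_cons, Nat.add_sub_cancel]
    rw [← mul_assoc, ← mul_assoc, ← sub_mul, pow_succ']
    exact Submodule.mul_mem_mul (hc b a) (list_prod_mem_pow hy l)
  | trans h h' ih ih' =>
    rw [← h.length_eq] at ih'
    simpa using Submodule.add_mem _ ih ih'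

/-- An algebra generated by a finite-dimensional subspace `V ∋ 1` spanned by elements whose
commutators and `p`-th powers lie in `V` is finite-dimensional. -/
theorem Module.Finite.of_commutator_mem_of_pow_mem [Fintype κ] (hp : 2 ≤ p) (h1 : 1 ∈ V)
    (hyV : V = Submodule.span k (Set.range y)) (hc : ∀ i j, y i * y j - y j * y i ∈ V)
    (hpow : ∀ i, y i ^ p ∈ V) (hgen : Algebra.adjoin k (V : Set A) = ⊤) : Module.Finite k A := by
  classical
  have hy : ∀ i, y i ∈ V := fun i => hyV ▸ Submodule.subset_span ⟨i, rfl⟩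
  have hV : (1 : Submodule k A) ≤ V := Submodule.one_le.mpr h1
  have mono : ∀ {a b : ℕ}, a ≤ b → V ^ a ≤ V ^ b := fun h => pow_le_pow_right₀ hV h
  -- A word longer than N repeats some letter at least p times; gathering these letters into a p-th
  -- power, which lies in V, shortens the word.
  set N := Fintype.card κ * (p - 1)
  have hword : ∀ l : List κ, N < l.length → (l.map y).prod ∈ V ^ (l.length - 1) := by
    intro l hl
    obtain ⟨i, hi⟩ : ∃ i, p ≤ l.count i := by
      by_contra! hcon
      have h2 : ∑ i : κ, l.count i ≤ ∑ _i : κ, (p - 1) :=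
        Finset.sum_le_sum fun i _ => by have := hcon i; omega
      have h3 : ∑ i : κ, l.count i = l.length := by
        have := Multiset.sum_count_eq_card (s := Finset.univ) (m := (l : Multiset κ)) (by simp)
        simpa using this
      rw [h3, Finset.sum_const, Finset.card_univ, smul_eq_mul] at h2
      omega
    obtain ⟨l', hl'⟩ : ∃ l', l.Perm (List.replicate p i ++ l') := by
      obtain ⟨l', hl'⟩ := (List.replicate_sublist_iff.mpr hi).exists_perm_append
      exact ⟨l', hl'⟩
    have hd := list_perm_prod_sub_prod_mem h1 hy hc hl'
    have hlen : l.length = p + l'.length := by simpa using hl'.length_eq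
    have hr : ((List.replicate p i ++ l').map y).prod ∈ V ^ (l.length - 1) := by
      rw [List.map_append, List.prod_append, List.map_replicate, List.prod_replicate]
      have := Submodule.mul_mem_mul (hpow i) (list_prod_mem_pow hy l')
      rw [← pow_succ'] at this
      -- The exponent 1 + |l'| is at most p + |l'| - 1 because p ≥ 2.
      exact mono (by omega) this
    simpa using Submodule.add_mem _ hd hr
  have hspan : ∀ d : ℕ, V ^ d ≤ Submodule.span k {a | ∃ l : List κ, l.length = d ∧
      (l.map y).prod = a} := by
    intro d
    induction d with
    | zero =>
      rw [pow_zero, Submodule.one_le]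
      exact Submodule.subset_span ⟨[], rfl, by simp⟩
    | succ d ih =>
      rw [pow_succ']
      refine (mul_le_mul' hyV.le ih).trans ?_
      rw [Submodule.span_mul_span]
      refine Submodule.span_mono ?_
      rintro _ ⟨_, ⟨i, rfl⟩, _, ⟨l, hl, rfl⟩, rfl⟩
      exact ⟨i :: l, by simp [hl], by simp⟩
  have hstep : ∀ d, V ^ (N + d) ≤ V ^ N := by
    intro d
    induction d with
    | zero => exact le_rfl
    | succ d ih =>
      refine le_trans ?_ ih
      refine (hspan _).trans (Submodule.span_le.mpr ?_)
      rintro _ ⟨l, hl, rfl⟩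
      have := hword l (by omega)
      rwa [hl, show N + (d + 1) - 1 = N + d by omega] at this
  have hall : ∀ d, V ^ d ≤ V ^ N := fun d => (mono (Nat.le_add_left d N)).trans (hstep d)
  -- All powers of V lie in V^N, so V^N is closed under multiplication and is a subalgebra
  -- containing the generators.
  have htop : V ^ N = ⊤ := by
    let T : Subalgebra k A := (V ^ N).toSubalgebra (Submodule.one_le.mp (by simpa using hall 0))
      fun a b ha hb => by
        have := Submodule.mul_mem_mul ha hb
        rw [← pow_add] at this
        exact hall _ this
    have hT : T = ⊤ := by
      rw [eq_top_iff, ← hgen, Algebra.adjoin_le_iff]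
      intro a ha
      have : a ∈ V ^ 1 := by rwa [pow_one]
      exact hall 1 this
    rw [eq_top_iff]
    intro a _
    have : a ∈ T := hT ▸ Algebra.mem_top
    exact this
  refine ⟨?_⟩
  rw [← htop]
  refine Submodule.FG.pow ?_ N
  rw [hyV]
  exact Submodule.fg_span (Set.finite_range y)

end Finiteness

/-! ### Generation and finite-dimensionality of U_χ(L). -/

namespace ReducedEnvelopingAlgebra

variable {k : Type u} [Field k] {L : Type v} [LieRing L] [LieAlgebra k L]
  (p : ℕ) (φ : L → L) (χ : Module.Dual k L)

theorem mk_surjective : Function.Surjective (mk p φ χ) :=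
  RingQuot.mkAlgHom_surjective k _

theorem adjoin_range_ι : Algebra.adjoin k (Set.range (ι p φ χ)) = ⊤ := by
  have h : Algebra.adjoin k (Set.range (UniversalEnvelopingAlgebra.ι k : L → _)) = ⊤ := by
    set T := Algebra.adjoin k (Set.range (UniversalEnvelopingAlgebra.ι k : L → _)) with hT
    let g : L →ₗ⁅k⁆ T :=
      { toFun := fun x => ⟨UniversalEnvelopingAlgebra.ι k x, Algebra.subset_adjoin ⟨x, rfl⟩⟩
        map_add' := fun x y => Subtype.ext (map_add _ x y)
        map_smul' := fun c x => Subtype.ext (map_smul _ c x)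
        map_lie' := fun {x y} => Subtype.ext ((UniversalEnvelopingAlgebra.ι k).map_lie x y) }
    have hid : T.val.comp (UniversalEnvelopingAlgebra.lift k g) = AlgHom.id k _ := by
      apply UniversalEnvelopingAlgebra.hom_ext
      ext x
      simp [g]
    rw [eq_top_iff]
    intro a _
    have := DFunLike.congr_fun hid a
    rw [AlgHom.id_apply] at this
    rw [← this]
    exact (UniversalEnvelopingAlgebra.lift k g a).2
  have h2 := congr_arg (Subalgebra.map (mk p φ χ)) h
  rw [AlgHom.map_adjoin, Algebra.map_top, (AlgHom.range_eq_top _).mpr (mk_surjective p φ χ),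
    ← Set.range_comp] at h2
  exact h2

/-- A property closed under the algebra operations holds on `U_χ(L)` if it holds on `L`. -/
theorem induction_on {C : ReducedEnvelopingAlgebra p φ χ → Prop}
    (hι : ∀ x, C (ι p φ χ x)) (hs : ∀ c : k, C (algebraMap k _ c))
    (hadd : ∀ a b, C a → C b → C (a + b)) (hmul : ∀ a b, C a → C b → C (a * b))
    (a : ReducedEnvelopingAlgebra p φ χ) : C a := by
  have ha : a ∈ Algebra.adjoin k (Set.range (ι p φ χ)) :=
    (adjoin_range_ι p φ χ) ▸ Algebra.mem_top
  induction ha using Algebra.adjoin_induction with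
  | mem x hx => obtain ⟨x, rfl⟩ := hx; exact hι x
  | algebraMap c => exact hs c
  | add a b _ _ h h' => exact hadd a b h h'
  | mul a b _ _ h h' => exact hmul a b h h'

theorem finite (hp : 2 ≤ p) [Module.Finite k L] :
    Module.Finite k (ReducedEnvelopingAlgebra p φ χ) := by
  let b := Module.finBasis k L
  -- The unit is added to a basis of L as an extra letter, so that the span contains the scalars
  -- χ(x)^p appearing in p-th powers.
  let y : Option (Fin (Module.finrank k L)) → ReducedEnvelopingAlgebra p φ χ :=
    fun o => o.elim 1 (fun i => ι p φ χ (b i))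
  have hι : ∀ x, ι p φ χ x ∈ Submodule.span k (Set.range y) := by
    intro x
    rw [← b.sum_repr x, ← LieHom.coe_toLinearMap, map_sum]
    refine Submodule.sum_mem _ fun i _ => ?_
    rw [map_smul]
    exact Submodule.smul_mem _ _ (Submodule.subset_span ⟨some i, rfl⟩)
  have h1 : (1 : ReducedEnvelopingAlgebra p φ χ) ∈ Submodule.span k (Set.range y) :=
    Submodule.subset_span ⟨none, rfl⟩
  refine Module.Finite.of_commutator_mem_of_pow_mem (y := y) hp h1 rfl ?_ ?_ ?_
  · rintro (_ | i) (_ | j)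
    · simp [y]
    · simp [y]
    · simp [y]
    · have := hι ⁅b i, b j⁆
      rwa [LieHom.map_lie] at this
  · rintro (_ | i)
    · simpa [y] using h1
    · change ι p φ χ (b i) ^ p ∈ _
      rw [ι_pow]
      refine Submodule.add_mem _ (hι _) ?_
      rw [Algebra.algebraMap_eq_smul_one]
      exact Submodule.smul_mem _ _ h1
  · rw [eq_top_iff, ← adjoin_range_ι p φ χ]
    refine Algebra.adjoin_mono ?_
    rintro _ ⟨x, rfl⟩
    exact hι x

end ReducedEnvelopingAlgebra

/-! ### Restriction to sl_n preserves indecomposability. -/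

section Restriction

variable {k : Type u} [Field k] {p : ℕ} [Fact p.Prime] [CharP k p] {n : ℕ}

/-- The canonical map `gl_n → U_χ(gl_n)`. -/
noncomputable abbrev glι (p : ℕ) [Fact p.Prime] [CharP k p]
    (χ : Module.Dual k (Matrix (Fin n) (Fin n) k)) :
    Matrix (Fin n) (Fin n) k →ₗ⁅k⁆ UGl p n χ :=
  ReducedEnvelopingAlgebra.ι p (fun x : Matrix (Fin n) (Fin n) k => x ^ p) χ

/-- The canonical map `sl_n → U_χ(sl_n)`. -/
noncomputable abbrev slι (p : ℕ) [Fact p.Prime] [CharP k p]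
    (χ : Module.Dual k (Matrix (Fin n) (Fin n) k)) :
    LieAlgebra.SpecialLinear.sl (Fin n) k →ₗ⁅k⁆ USl p n (resChar n χ) :=
  ReducedEnvelopingAlgebra.ι p (slPow p n) (resChar n χ)

omit [CharP k p] in
variable (k p n) in
/-- `gl_n = sl_n + k E` for some toral element `E`. -/
theorem exists_toral_complement : ∃ E : Matrix (Fin n) (Fin n) k, E ^ p = E ∧
    ∀ x : Matrix (Fin n) (Fin n) k,
      ∃ (c : k) (y : LieAlgebra.SpecialLinear.sl (Fin n) k), x = y.1 + c • E := by
  cases n with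
  | zero => exact ⟨0, Subsingleton.elim _ _, fun x => ⟨0, 0, Subsingleton.elim _ _⟩⟩
  | succ n =>
    -- E_11 has trace 1 in every characteristic, whereas the identity matrix lies in sl_n when p
    -- divides n.
    refine ⟨Matrix.diagonal (Pi.single 0 1), ?_, fun x => ⟨x.trace,
      ⟨x - x.trace • Matrix.diagonal (Pi.single 0 1), ?_⟩, (sub_add_cancel _ _).symm⟩⟩
    · rw [Matrix.diagonal_pow]
      congr 1
      ext i
      rcases eq_or_ne i 0 with rfl | hi
      · simp
      · simp [hi, (Fact.out : p.Prime).ne_zero]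
    · change Matrix.trace (x - x.trace • Matrix.diagonal (Pi.single 0 1)) = 0
      simp

theorem lie_mem_sl (x y : Matrix (Fin n) (Fin n) k) :
    ⁅x, y⁆ ∈ LieAlgebra.SpecialLinear.sl (Fin n) k := by
  change Matrix.trace (x * y - y * x) = 0
  rw [Matrix.trace_sub, Matrix.trace_mul_comm, sub_self]

/-- An additive map commuting with scalars, `sl_n` and `E` is `U_χ(gl_n)`-linear. -/
theorem map_smul_of_toral (χ : Module.Dual k (Matrix (Fin n) (Fin n) k)) {M : Type v}
    {N : Type w} [AddCommGroup M] [Module (UGl p n χ) M] [AddCommGroup N] [Module (UGl p n χ) N]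
    {E : Matrix (Fin n) (Fin n) k}
    (hE : ∀ x : Matrix (Fin n) (Fin n) k,
      ∃ (c : k) (y : LieAlgebra.SpecialLinear.sl (Fin n) k), x = y.1 + c • E)
    (f : M →+ N) (hk : ∀ (c : k) m, f (algebraMap k (UGl p n χ) c • m) =
      algebraMap k (UGl p n χ) c • f m)
    (hs : ∀ (y : LieAlgebra.SpecialLinear.sl (Fin n) k) m, f (glι p χ y.1 • m) =
      glι p χ y.1 • f m)
    (hf : ∀ m, f (glι p χ E • m) = glι p χ E • f m) (a : UGl p n χ) (m : M) :
    f (a • m) = a • f m := by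
  induction a using ReducedEnvelopingAlgebra.induction_on generalizing m with
  | hι x =>
    obtain ⟨c, y, rfl⟩ := hE x
    rw [map_add, map_smul (glι p χ), add_smul, add_smul, map_add, hs, Algebra.smul_def, mul_smul,
      mul_smul, hk, hf]
  | hs c => exact hk c m
  | hadd a b ha hb => rw [add_smul, add_smul, map_add, ha, hb]
  | hmul a b ha hb => rw [mul_smul, mul_smul, ha, hb]

/-- A decomposition of the restriction is given by the projection onto one summand along the other,
an idempotent commuting with the image S of sl_n. Brackets with E preserve S because [gl_n, gl_n] ⊆
sl_n. -/
theorem isIndecomposable_res [IsAlgClosed k] (χ : Module.Dual k (Matrix (Fin n) (Fin n) k))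
    (M : Type v) [AddCommGroup M] [Module k M] [Module (UGl p n χ) M]
    [IsScalarTower k (UGl p n χ) M] [Module.Finite k M]
    (hM : IsIndecomposable (UGl p n χ) M) :
    IsIndecomposable (USl p n (resChar n χ)) (Res n χ M) := by
  have := isNoetherian_of_tower k (inferInstance : IsNoetherian k M) (S := UGl p n χ)
  have := isArtinian_of_tower k (inferInstance : IsArtinian k M) (S := UGl p n χ)
  have := hM.isLocalRing_end
  have : SMulCommClass k (UGl p n χ) M := IsScalarTower.to_smulCommClass
  obtain ⟨E, hEp, hE⟩ := exists_toral_complement k p n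
  refine ⟨hM.1, fun N₁ N₂ hN => ?_⟩
  let ρ : UGl p n χ →ₐ[k] Module.End k M := Algebra.lsmul k k M
  have hρ : ∀ a m, ρ a m = a • m := fun _ _ => rfl
  let g : Res n χ M →ₗ[USl p n (resChar n χ)] Res n χ M := N₁.projection N₂ hN
  let g' : M → M := g
  have hgs : ∀ b (m : M), g' (slToGl p n χ b • m) = slToGl p n χ b • g' m :=
    fun b m => g.map_smul b m
  let e : Module.End k M :=
    { toFun := g'
      map_add' := fun x y => map_add g x y
      map_smul' := fun c m => by
        have := hgs (algebraMap k _ c) m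
        rw [AlgHom.commutes, algebraMap_smul, algebraMap_smul] at this
        exact this }
  have hee : e * e = e := by
    ext m
    exact Submodule.projection_apply_of_mem_left hN (Submodule.projection_apply_mem hN m)
  have hidem := idempotent_eq_zero_or_one (p := p) (A := UGl p n χ) (V := M)
    (S := Set.range fun y : LieAlgebra.SpecialLinear.sl (Fin n) k => ρ (glι p χ y.1))
    (d := ρ (glι p χ E)) (c := χ E ^ p) (e := e) ?_ ?_ ?_ hee ?_
  · rcases hidem with h | h
    · left
      rw [eq_bot_iff]
      intro x hx
      have h1 : g x = x := Submodule.projection_apply_of_mem_left hN hx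
      have h2 : g x = 0 := LinearMap.congr_fun h x
      rw [Submodule.mem_bot, ← h1, h2]
    · right
      rw [eq_bot_iff]
      intro x hx
      have h1 : g x = 0 := Submodule.projection_apply_of_mem_right hN hx
      have h2 : g x = x := LinearMap.congr_fun h x
      rw [Submodule.mem_bot, ← h2, h1]
  · intro r hr hrE
    refine ⟨{ toFun := r, map_add' := map_add r, map_smul' := fun a m => ?_ }, fun v => rfl⟩
    refine map_smul_of_toral χ hE r.toAddMonoidHom (fun c m => ?_) (fun y m => ?_) (fun m => ?_) a m
    · simp
    · exact LinearMap.congr_fun (hr _ ⟨y, rfl⟩).eq m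
    · exact LinearMap.congr_fun hrE.eq m
  · rw [← map_pow, ReducedEnvelopingAlgebra.ι_pow, map_add, AlgHom.commutes, hEp]
  · rintro _ ⟨y, rfl⟩
    refine ⟨⟨⁅E, y.1⁆, lie_mem_sl _ _⟩, ?_⟩
    change ρ (glι p χ ⁅E, y.1⁆) = _
    rw [LieHom.map_lie, LieRing.of_associative_ring_bracket, map_sub, map_mul, map_mul]
  · rintro _ ⟨y, rfl⟩
    ext m
    have := hgs (slι p χ y) m
    rw [slToGl_ι] at this
    exact this

end Restriction

/-! ### Indecomposable projectives over artinian rings and projective covers. -/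

section ProjectiveModules

variable {R : Type u} [Ring R] {P : Type v} [AddCommGroup P] [Module R P]

/-- P is not assumed finitely generated. Semiprimary induction reduces to semisimple modules: along
an extension, a coatom comes from the quotient if it is nonzero, and otherwise from the submodule.
-/
theorem exists_isCoatom_of_isArtinianRing [IsArtinianRing R] [Nontrivial P] :
    ∃ K : Submodule R P, IsCoatom K := by
  suffices h : Nontrivial P → ∃ K : Submodule R P, IsCoatom K from h inferInstance
  refine IsSemiprimaryRing.induction R R P
    (P := fun M _ _ _ => Nontrivial M → ∃ K : Submodule R M, IsCoatom K) ?_ ?_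
  · intro M _ _ _ _ _ _ hM
    rcases eq_top_or_exists_le_coatom (⊥ : Submodule R M) with h | ⟨K, hK, -⟩
    · exact absurd h bot_ne_top
    · exact ⟨K, hK⟩
  · intro M _ _ _ _ N hN hQ hM
    by_cases hNt : N = ⊤
    · let f : M →ₗ[R] N := LinearMap.codRestrict N LinearMap.id (fun m => hNt ▸ Submodule.mem_top)
      have hf : Function.Surjective f := fun x => ⟨x.1, rfl⟩
      have hn : Nontrivial N := by
        rw [hNt]
        exact (Submodule.topEquiv (R := R) (M := M)).toEquiv.nontrivial
      obtain ⟨K, hK⟩ := hN hn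
      exact ⟨K.comap f, (Submodule.isCoatom_comap_iff hf).mpr hK⟩
    · obtain ⟨K, hK⟩ := hQ (Submodule.Quotient.nontrivial_iff.mpr hNt)
      exact ⟨K.comap N.mkQ, (Submodule.isCoatom_comap_iff N.mkQ_surjective).mpr hK⟩

theorem IsIndecomposable.injective_of_comp_eq_id (hP : IsIndecomposable R P) {Q : Type w}
    [AddCommGroup Q] [Module R Q] [Nontrivial Q] {f : P →ₗ[R] Q} {s : Q →ₗ[R] P}
    (h : f ∘ₗ s = LinearMap.id) : Function.Injective f := by
  have hfs : ∀ x, f (s x) = x := fun x => LinearMap.congr_fun h x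
  have hi : IsIdempotentElem (s ∘ₗ f : Module.End R P) :=
    LinearMap.ext fun x => by simp [hfs]
  have hs : Function.Injective s := Function.LeftInverse.injective hfs
  rcases hP.2 _ _ (LinearMap.IsIdempotentElem.isCompl hi) with h' | h'
  · exfalso
    obtain ⟨x, hx⟩ := exists_ne (0 : Q)
    have h0 : s ∘ₗ f = 0 := LinearMap.range_eq_bot.mp h'
    have h1 := LinearMap.congr_fun h0 (s x)
    rw [LinearMap.comp_apply, hfs, LinearMap.zero_apply] at h1
    exact hx (hs (by rw [h1, map_zero]))
  · rw [LinearMap.ker_comp_of_ker_eq_bot _ (LinearMap.ker_eq_bot.mpr hs)] at h'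
    exact LinearMap.ker_eq_bot.mp h'

/-- An indecomposable projective module over an artinian ring is finitely generated. -/
theorem IsIndecomposable.finite_of_projective [IsArtinianRing R] [Module.Projective R P]
    (hP : IsIndecomposable R P) : Module.Finite R P := by
  have := hP.1
  obtain ⟨K, hK⟩ := exists_isCoatom_of_isArtinianRing (R := R) (P := P)
  have hS : IsSimpleModule R (P ⧸ K) := isSimpleModule_iff_isCoatom.mpr hK
  have hSn : Nontrivial (P ⧸ K) := IsSimpleModule.nontrivial R _
  -- A minimal member of T plays the role of the projective cover of P/K, whose existence is thus
  -- not needed beforehand.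
  let T : Set (Submodule R R) := {I | Module.Projective R I ∧
    ∃ q : I →ₗ[R] (P ⧸ K), Function.Surjective q}
  have hT : (⊤ : Submodule R R) ∈ T := by
    refine ⟨Module.Projective.of_equiv' Submodule.topEquiv.symm, ?_⟩
    obtain ⟨x, hx⟩ := exists_ne (0 : P ⧸ K)
    exact ⟨LinearMap.toSpanSingleton R _ x ∘ₗ Submodule.topEquiv.toLinearMap,
      (IsSimpleModule.toSpanSingleton_surjective R hx).comp Submodule.topEquiv.surjective⟩
  obtain ⟨I, ⟨hIp, q, hq⟩, hmin⟩ := WellFounded.has_min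
    (wellFounded_lt (α := Submodule R R)) T ⟨⊤, hT⟩
  obtain ⟨f, hf⟩ := Module.projective_lifting_property q K.mkQ hq
  obtain ⟨g, hg⟩ := Module.projective_lifting_property K.mkQ q K.mkQ_surjective
  let h : Module.End R I := f ∘ₗ g
  have hqh : ∀ (m : ℕ) x, q ((h ^ m) x) = q x := by
    intro m
    induction m with
    | zero => simp
    | succ m ih =>
      intro x
      rw [pow_succ, Module.End.mul_apply, ih]
      change (q ∘ₗ f) (g x) = _
      rw [hf]
      exact LinearMap.congr_fun hg x
  obtain ⟨m, hm⟩ := Filter.eventually_atTop.mp h.eventually_isCompl_ker_pow_range_pow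
  have hc := hm (m + 1) (Nat.le_succ m)
  -- By Fitting this range is a direct summand of I, hence projective; it still maps onto P/K
  -- because q ∘ h = q. Minimality forces it to be all of I, so f is surjective.
  set r := LinearMap.range (h ^ (m + 1)) with hr
  have hrp : Module.Projective R r :=
    Module.Projective.of_split r.subtype (Submodule.projectionOnto r _ hc.symm)
      (LinearMap.ext fun x => Submodule.projectionOnto_apply_left hc.symm x)
  have hmem : r.map I.subtype ∈ T := by
    let e := Submodule.equivMapOfInjective I.subtype I.injective_subtype r
    refine ⟨Module.Projective.of_equiv' e, q ∘ₗ r.subtype ∘ₗ e.symm.toLinearMap, ?_⟩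
    intro y
    obtain ⟨x, rfl⟩ := hq y
    exact ⟨e ⟨(h ^ (m + 1)) x, ⟨x, rfl⟩⟩, by simp [hqh]⟩
  have hle : r.map I.subtype ≤ I := Submodule.map_subtype_le I r
  have heq : r.map I.subtype = I := by
    by_contra hne
    exact hmin _ hmem (lt_of_le_of_ne hle hne)
  have hrt : r = ⊤ := by
    refine Submodule.map_injective_of_injective I.injective_subtype ?_
    rw [heq, Submodule.map_top, Submodule.range_subtype]
  have hfs : Function.Surjective f := by
    intro x
    obtain ⟨y, hy⟩ : x ∈ r := hrt ▸ Submodule.mem_top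
    rw [pow_succ'] at hy
    exact ⟨g ((h ^ m) y), hy⟩
  obtain ⟨s, hs⟩ := Module.projective_lifting_property f LinearMap.id hfs
  have hIn : Nontrivial I := hq.nontrivial
  have hfi := hP.injective_of_comp_eq_id hs
  exact Module.Finite.equiv (LinearEquiv.ofBijective f ⟨hfi, hfs⟩).symm

/-- The kernel of π is both maximal and superfluous: a summand not contained in it is everything,
and if one summand is contained in it, the other is everything. -/
theorem IsProjectiveCover.isIndecomposable {M : Type w} [AddCommGroup M] [Module R M]
    [IsSimpleModule R M] {π : P →ₗ[R] M} (h : IsProjectiveCover π) : IsIndecomposable R P := by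
  have := IsSimpleModule.nontrivial R M
  refine ⟨h.surjective.nontrivial, fun N₁ N₂ hN => ?_⟩
  have hK : IsCoatom (LinearMap.ker π) := LinearMap.isCoatom_ker_of_surjective h.surjective
  by_cases h1 : N₁ ≤ LinearMap.ker π
  · left
    have h2 : N₂ ⊔ LinearMap.ker π = ⊤ := by
      rw [eq_top_iff, ← hN.symm.sup_eq_top]
      exact sup_le_sup_left h1 _
    have := h.superfluous _ h2
    subst this
    exact hN.inf_eq_bot ▸ (inf_top_eq _).symm
  · right
    have h2 : N₁ ⊔ LinearMap.ker π = ⊤ := hK.2 _ (right_lt_sup.mpr h1)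
    have := h.superfluous _ h2
    subst this
    exact hN.inf_eq_bot ▸ (top_inf_eq _).symm

/-- An indecomposable projective module of finite length is the projective cover of a simple
module. -/
theorem IsIndecomposable.isProjectiveCover_mkQ [IsNoetherian R P] [IsArtinian R P]
    [Module.Projective R P] (hP : IsIndecomposable R P) {K : Submodule R P} (hK : IsCoatom K) :
    IsProjectiveCover K.mkQ := by
  refine ⟨inferInstance, K.mkQ_surjective, fun N hN => ?_⟩
  have hs : Function.Surjective (K.mkQ ∘ₗ N.subtype) := by
    rw [← LinearMap.range_eq_top, LinearMap.range_comp, Submodule.range_subtype]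
    have := congr_arg (Submodule.map K.mkQ) hN
    rwa [Submodule.map_sup, Submodule.ker_mkQ, Submodule.mkQ_map_self, sup_bot_eq,
      Submodule.map_top, Submodule.range_mkQ] at this
  obtain ⟨g, hg⟩ := Module.projective_lifting_property _ K.mkQ hs
  -- This endomorphism has image in N and induces the identity on P/K ≠ 0, so it cannot be
  -- nilpotent; being a unit, it forces N = P.
  let h : Module.End R P := N.subtype ∘ₗ g
  have hh : ∀ (m : ℕ) x, K.mkQ ((h ^ m) x) = K.mkQ x := by
    intro m
    induction m with
    | zero => simp
    | succ m ih =>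
      intro x
      rw [pow_succ, Module.End.mul_apply, ih]
      exact LinearMap.congr_fun hg x
  rcases hP.isUnit_or_isNilpotent h with hu | ⟨m, hm⟩
  · rw [eq_top_iff]
    intro x _
    obtain ⟨y, rfl⟩ := ((Module.End.isUnit_iff _).mp hu).2 x
    exact (g y).2
  · exfalso
    refine hK.1 (eq_top_iff.mpr fun x _ => ?_)
    rw [← Submodule.ker_mkQ K, LinearMap.mem_ker, ← hh m, hm, LinearMap.zero_apply, map_zero]

end ProjectiveModules

/-! ### Binomial identities in characteristic p and a weak Jacobson formula. -/

section Jacobson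

open Finset

theorem neg_one_pow_eq_choose_of_lt {R : Type u} [Ring R] {p : ℕ} (hp : p.Prime)
    (hR : (p : R) = 0) {i : ℕ} (hi : i < p) : ((p - 1).choose i : R) = (-1) ^ i := by
  induction i with
  | zero => simp
  | succ i ih =>
    have h1 : p.choose (i + 1) = (p - 1).choose i + (p - 1).choose (i + 1) := by
      have := Nat.choose_succ_succ (p - 1) i
      rwa [Nat.succ_eq_add_one, Nat.sub_add_cancel hp.one_lt.le] at this
    have h2 : (p.choose (i + 1) : R) = 0 := by
      obtain ⟨c, hc⟩ := hp.dvd_choose_self (Nat.succ_ne_zero i) hi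
      rw [hc, Nat.cast_mul, hR, zero_mul]
    rw [h1, Nat.cast_add, ih (by omega)] at h2
    rw [pow_succ, mul_neg_one, ← add_eq_zero_iff_eq_neg', h2]

theorem Commute.sub_pow_char_sub_one {R : Type u} [Ring R] {p : ℕ} (hp : p.Prime)
    (hR : (p : R) = 0) {x y : R} (h : Commute x y) :
    (x - y) ^ (p - 1) = ∑ i ∈ range p, x ^ i * y ^ (p - 1 - i) := by
  rw [sub_eq_add_neg, h.neg_right.add_pow, Nat.sub_add_cancel hp.one_lt.le]
  refine sum_congr rfl fun i hi => ?_
  have hi' := mem_range.mp hi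
  rw [← Nat.choose_symm (by omega : i ≤ p - 1),
    neg_one_pow_eq_choose_of_lt hp hR (by omega : p - 1 - i < p), neg_pow, mul_assoc, mul_assoc,
    ← (Commute.neg_one_left (y ^ (p - 1 - i)) |>.pow_left _).eq, ← mul_assoc ((-1) ^ _), ← mul_pow]
  · simp
  · exact Commute.refl _

/-- After expansion, the power sum of j^e over ZMod p vanishes for e < p - 1 and is -1 for e = p -
1, so only the term with x^0 survives. This makes the weight projections 1 - (x - j)^(p-1) add up to
1. -/
theorem sum_sub_pow_char_sub_one {k : Type u} [Field k] {R : Type v} [Ring R] [Algebra k R] {p : ℕ}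
    [Fact p.Prime] [CharP k p] (x : R) :
    ∑ j : ZMod p, (x - algebraMap k R (ZMod.castHom dvd_rfl k j)) ^ (p - 1) = -1 := by
  have hp := (Fact.out : p.Prime)
  have hR : (p : R) = 0 := by
    rw [← map_natCast (algebraMap k R), CharP.cast_eq_zero, map_zero]
  have h1 : ∀ j : ZMod p, (x - algebraMap k R (ZMod.castHom dvd_rfl k j)) ^ (p - 1) =
      ∑ i ∈ range p, x ^ i * algebraMap k R (ZMod.castHom dvd_rfl k (j ^ (p - 1 - i))) := by
    intro j
    rw [(Algebra.commute_algebraMap_right _ x).sub_pow_char_sub_one hp hR]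
    simp only [map_pow]
  simp only [h1]
  rw [sum_comm]
  simp only [← mul_sum, ← map_sum]
  rw [sum_eq_single 0]
  · have h2 : ∑ j : ZMod p, j ^ (p - 1 - 0) = -1 := by
      have := FiniteField.sum_pow_units (ZMod p) (p - 1)
      rw [ZMod.card, if_pos dvd_rfl] at this
      rw [Nat.sub_zero, ← this]
      have h0 : p - 1 ≠ 0 := by have := hp.two_le; omega
      exact (Fintype.sum_of_injective (fun u : (ZMod p)ˣ => (u : ZMod p)) Units.val_injective _ _
        (fun j hj => by
          have : j = 0 := by
            by_contra hj0
            exact hj ⟨Units.mk0 j hj0, rfl⟩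
          rw [this, zero_pow h0]) (fun u => by simp)).symm
    rw [h2]
    simp
  · intro i hi hi0
    have hi' := mem_range.mp hi
    have := FiniteField.sum_pow_lt_card_sub_one (ZMod p) (p - 1 - i)
      (by rw [ZMod.card]; omega)
    rw [this, map_zero, map_zero, mul_zero]
  · intro h
    exact absurd (mem_range.mpr hp.pos) h

theorem derivative_pow_eq_sum {A : Type u} [Ring A] (f : Polynomial A) (m : ℕ) :
    Polynomial.derivative (f ^ m) =
      ∑ i ∈ range m, f ^ i * Polynomial.derivative f * f ^ (m - 1 - i) := by
  induction m with
  | zero => simp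
  | succ m ih =>
    rw [pow_succ, Polynomial.derivative_mul, ih, sum_range_succ, sum_mul, Nat.add_sub_cancel,
      Nat.sub_self, pow_zero, mul_one]
    congr 1
    refine sum_congr rfl fun i hi => ?_
    have := mem_range.mp hi
    rw [mul_assoc, ← pow_succ]
    congr 2
    omega

theorem derivative_pow_char {A : Type u} [Ring A] {p : ℕ} (hp : p.Prime) (hA : (p : A) = 0)
    (f : Polynomial A) :
    Polynomial.derivative (f ^ p) =
      ((LinearMap.mulLeft ℤ f - LinearMap.mulRight ℤ f) ^ (p - 1)) (Polynomial.derivative f) := by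
  have hE : (p : Module.End ℤ (Polynomial A)) = 0 := by
    ext1 g
    rw [Module.End.natCast_apply, ← Nat.cast_smul_eq_nsmul A, hA, zero_smul, LinearMap.zero_apply]
  rw [(LinearMap.commute_mulLeft_right (R := ℤ) f f).sub_pow_char_sub_one hp hE,
    derivative_pow_eq_sum, LinearMap.sum_apply]
  refine sum_congr rfl fun i _ => ?_
  rw [Module.End.mul_apply, LinearMap.pow_mulLeft, LinearMap.pow_mulRight,
    LinearMap.mulLeft_apply, LinearMap.mulRight_apply, mul_assoc]

/-- A weak form of Jacobson's formula: `(x + y) ^ p - x ^ p - y ^ p` lies in every Lie subalgebra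
containing `x` and `y`. -/
theorem add_pow_char_sub_mem {k : Type u} [Field k] {A : Type v} [Ring A] [Algebra k A] {p : ℕ}
    [Fact p.Prime] [CharP k p] (S : Submodule k A) (hS : ∀ a ∈ S, ∀ b ∈ S, a * b - b * a ∈ S)
    {x y : A} (hx : x ∈ S) (hy : y ∈ S) : (x + y) ^ p - x ^ p - y ^ p ∈ S := by
  have hp := (Fact.out : p.Prime)
  have hA : (p : A) = 0 := by
    rw [← map_natCast (algebraMap k A), CharP.cast_eq_zero, map_zero]
  -- The derivative of q^p is (ad q)^(p-1)(x), whose coefficients lie in S because bracketing with q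
  -- preserves polynomials with coefficients in S.
  let q : Polynomial A := Polynomial.C x * Polynomial.X + Polynomial.C y
  have hstep : ∀ g : Polynomial A, (∀ m, g.coeff m ∈ S) →
      ∀ m, ((LinearMap.mulLeft ℤ q - LinearMap.mulRight ℤ q) g).coeff m ∈ S := by
    intro g hg m
    have he : (LinearMap.mulLeft ℤ q - LinearMap.mulRight ℤ q) g =
        (Polynomial.C x * g - g * Polynomial.C x) * Polynomial.X +
          (Polynomial.C y * g - g * Polynomial.C y) := by
      change q * g - g * q = _
      simp only [q, add_mul, mul_add, sub_mul, mul_assoc]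
      rw [Polynomial.X_mul (p := g)]
      abel
    rw [he, Polynomial.coeff_add]
    refine S.add_mem ?_ ?_
    · cases m with
      | zero => rw [Polynomial.coeff_mul_X_zero]; exact S.zero_mem
      | succ m =>
        rw [Polynomial.coeff_mul_X, Polynomial.coeff_sub, Polynomial.coeff_C_mul,
          Polynomial.coeff_mul_C]
        exact hS _ hx _ (hg m)
    · rw [Polynomial.coeff_sub, Polynomial.coeff_C_mul, Polynomial.coeff_mul_C]
      exact hS _ hy _ (hg m)
  have hiter : ∀ j m, (((LinearMap.mulLeft ℤ q - LinearMap.mulRight ℤ q) ^ j)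
      (Polynomial.C x)).coeff m ∈ S := by
    intro j
    induction j with
    | zero =>
      intro m
      rw [pow_zero, Module.End.one_apply, Polynomial.coeff_C]
      split_ifs
      · exact hx
      · exact S.zero_mem
    | succ j ih => intro m; rw [pow_succ', Module.End.mul_apply]; exact hstep _ ih m
  have hder : Polynomial.derivative q = Polynomial.C x := by simp [q]
  -- Differentiation multiplies the coefficient of degree m + 1 by m + 1, which is invertible in k
  -- below p. Setting X = 1 then leaves only the extreme coefficients x^p and y^p outside this
  -- argument.
  have hcoeff : ∀ m, m + 1 < p → (q ^ p).coeff (m + 1) ∈ S := by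
    intro m hm
    have h1 := hiter (p - 1) m
    rw [← hder, ← derivative_pow_char hp hA, Polynomial.coeff_derivative] at h1
    have h2 : ((m + 1 : ℕ) : k) ≠ 0 := by
      rw [Ne, CharP.cast_eq_zero_iff k p]
      exact fun h => absurd (Nat.le_of_dvd (Nat.succ_pos m) h) (by omega)
    have h3 : (q ^ p).coeff (m + 1) * ((m : A) + 1) = ((m + 1 : ℕ) : k) • (q ^ p).coeff (m + 1) := by
      rw [Nat.cast_smul_eq_nsmul, nsmul_eq_mul, Nat.cast_comm, Nat.cast_succ]
    rw [h3] at h1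
    exact (S.smul_mem_iff h2).mp h1
  have hdeg : q.natDegree ≤ 1 := Polynomial.natDegree_linear_le
  have htop : (q ^ p).coeff p = x ^ p := by
    have := Polynomial.coeff_pow_of_natDegree_le hdeg (m := p)
    rw [mul_one] at this
    rw [this]
    simp [q]
  have hzero : (q ^ p).coeff 0 = y ^ p := by
    have := map_pow (Polynomial.constantCoeff (R := A)) q p
    simpa [q] using this
  have heval : ∑ i ∈ range (p + 1), (q ^ p).coeff i = (x + y) ^ p := by
    let ev := Polynomial.eval₂RingHom' (RingHom.id A) 1 (fun a => Commute.one_right a)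
    have h1 : ev (q ^ p) = (x + y) ^ p := by
      rw [map_pow]
      congr 1
      simp [ev, q]
    have hd : (q ^ p).natDegree < p + 1 := by
      have := Polynomial.natDegree_pow_le_of_le p hdeg
      omega
    rw [← h1]
    change _ = Polynomial.eval₂ _ _ _
    rw [Polynomial.eval₂_eq_sum_range' _ hd]
    simp
  rw [sum_range_succ, htop] at heval
  obtain ⟨r, rfl⟩ : ∃ r, p = r + 1 := ⟨p - 1, (Nat.sub_add_cancel hp.one_lt.le).symm⟩
  rw [sum_range_succ', hzero] at heval
  rw [← heval, show ∑ i ∈ range r, (q ^ (r + 1)).coeff (i + 1) + y ^ (r + 1) + x ^ (r + 1) -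
    x ^ (r + 1) - y ^ (r + 1) = ∑ i ∈ range r, (q ^ (r + 1)).coeff (i + 1) by abel]
  refine S.sum_mem fun i hi => hcoeff i ?_
  have := mem_range.mp hi
  omega

end Jacobson

/-! ### The coinduced gl_n-action on functions ZMod p → N. -/

section Coinduction

set_option linter.unusedSectionVars false

variable {k : Type u} [Field k] {p : ℕ} [Fact p.Prime] [CharP k p] {m : ℕ}

/-- The prime field of `k`. -/
abbrev primeCast (k : Type u) [Field k] (p : ℕ) [CharP k p] : ZMod p →+* k :=
  ZMod.castHom dvd_rfl k

theorem primeCast_pow_char (j : ZMod p) : primeCast k p j ^ p = primeCast k p j := by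
  rw [← map_pow, ZMod.pow_card]

/-- The toral element `E_{11}` of `gl_n`. -/
def toralElt (k : Type u) [Field k] (m : ℕ) : Matrix (Fin (m + 1)) (Fin (m + 1)) k :=
  Matrix.diagonal (Pi.single 0 1)

/-- The weights of `E_{11}` on the standard module. -/
def toralWeight (p m : ℕ) : Fin (m + 1) → ZMod p := Pi.single 0 1

theorem primeCast_toralWeight (a : Fin (m + 1)) :
    primeCast k p (toralWeight p m a) = (Pi.single 0 1 : Fin (m + 1) → k) a := by
  rcases eq_or_ne a 0 with rfl | h
  · simp [toralWeight]
  · simp [toralWeight, h]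

theorem trace_toralElt : Matrix.trace (toralElt k m) = 1 := by
  simp [toralElt]

theorem toralElt_pow_char : toralElt k m ^ p = toralElt k m := by
  rw [toralElt, Matrix.diagonal_pow]
  congr 1
  ext i
  rcases eq_or_ne i 0 with rfl | hi
  · simp
  · simp [hi, (Fact.out : p.Prime).ne_zero]

/-- The component of a matrix of degree `g` under `ad E_{11}`. -/
def degreePart (g : ZMod p) :
    Matrix (Fin (m + 1)) (Fin (m + 1)) k →ₗ[k] Matrix (Fin (m + 1)) (Fin (m + 1)) k where
  toFun x := Matrix.of fun a b => if toralWeight p m a - toralWeight p m b = g then x a b else 0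
  map_add' x y := by
    ext a b
    simp only [Matrix.of_apply, Matrix.add_apply]
    split_ifs <;> simp
  map_smul' c x := by
    ext a b
    simp

theorem degreePart_apply (g : ZMod p) (x : Matrix (Fin (m + 1)) (Fin (m + 1)) k)
    (a b : Fin (m + 1)) : degreePart g x a b =
      if toralWeight p m a - toralWeight p m b = g then x a b else 0 := rfl

theorem sum_degreePart (x : Matrix (Fin (m + 1)) (Fin (m + 1)) k) :
    ∑ g : ZMod p, degreePart g x = x := by
  ext a b
  simp [Matrix.sum_apply, degreePart_apply]

theorem degreePart_degreePart (g h : ZMod p) (x : Matrix (Fin (m + 1)) (Fin (m + 1)) k) :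
    degreePart h (degreePart g x) = if h = g then degreePart g x else 0 := by
  ext a b
  rw [degreePart_apply, degreePart_apply]
  split_ifs with h1 h2 h3 h3
  · rw [degreePart_apply, if_pos h2]
  · exact absurd (h1.symm.trans h2) h3
  · exact absurd (h1.trans h3) h2
  · rfl
  · rw [degreePart_apply, if_neg]
    rintro rfl
    exact h1 (Eq.symm ‹_›)
  · rfl

theorem degreePart_mul (l : ZMod p) (x y : Matrix (Fin (m + 1)) (Fin (m + 1)) k) :
    degreePart l (x * y) = ∑ g : ZMod p, degreePart g x * degreePart (l - g) y := by
  ext a b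
  rw [degreePart_apply, Matrix.sum_apply]
  simp only [Matrix.mul_apply, degreePart_apply]
  rw [Finset.sum_comm]
  have : ∀ c, ∑ g : ZMod p, ((if toralWeight p m a - toralWeight p m c = g then x a c else 0) *
      if toralWeight p m c - toralWeight p m b = l - g then y c b else 0) =
      if toralWeight p m a - toralWeight p m b = l then x a c * y c b else 0 := by
    intro c
    rw [Finset.sum_eq_single (toralWeight p m a - toralWeight p m c)]
    · rw [if_pos rfl]
      have : toralWeight p m c - toralWeight p m b =
          l - (toralWeight p m a - toralWeight p m c) ↔
          toralWeight p m a - toralWeight p m b = l := by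
        constructor
        · intro h; linear_combination h
        · intro h; linear_combination h
      simp only [this, mul_ite, mul_zero]
    · intro g _ hg
      rw [if_neg (Ne.symm hg), zero_mul]
    · simp
  simp only [this]
  split_ifs <;> simp

theorem degreePart_lie (l : ZMod p) (x y : Matrix (Fin (m + 1)) (Fin (m + 1)) k) :
    degreePart l ⁅x, y⁆ = ∑ g : ZMod p, ⁅degreePart g x, degreePart (l - g) y⁆ := by
  simp only [LieRing.of_associative_ring_bracket]
  rw [map_sub, degreePart_mul, degreePart_mul, Finset.sum_sub_distrib]
  congr 1
  refine Fintype.sum_equiv (Equiv.subLeft l) _ _ fun g => ?_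
  simp

theorem degreePart_toralElt_lie (g : ZMod p) (x : Matrix (Fin (m + 1)) (Fin (m + 1)) k) :
    degreePart g ⁅toralElt k m, x⁆ = primeCast k p g • degreePart g x := by
  ext a b
  rw [Matrix.smul_apply, degreePart_apply, degreePart_apply]
  split_ifs with h
  · rw [LieRing.of_associative_ring_bracket, toralElt, Matrix.sub_apply, Matrix.diagonal_mul,
      Matrix.mul_diagonal, ← h, map_sub, primeCast_toralWeight, primeCast_toralWeight, smul_eq_mul]
    ring
  · rw [smul_zero]

theorem trace_degreePart (g : ZMod p) (x : Matrix (Fin (m + 1)) (Fin (m + 1)) k)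
    (hx : x.trace = 0) : (degreePart g x).trace = 0 := by
  rw [Matrix.trace]
  simp only [Matrix.diag_apply, degreePart_apply, sub_self]
  split_ifs
  · exact hx
  · simp

/-- Used with j = p: the p-th power of a homogeneous matrix has degree 0. -/
theorem degreePart_pow_of_eq {g : ZMod p} {x : Matrix (Fin (m + 1)) (Fin (m + 1)) k}
    (hx : degreePart g x = x) (j : ℕ) : degreePart ((j : ZMod p) * g) (x ^ j) = x ^ j := by
  induction j with
  | zero =>
    ext a b
    rw [degreePart_apply, pow_zero]
    split_ifs with h
    · rfl
    · rw [Matrix.one_apply_ne]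
      rintro rfl
      simp at h
  | succ j ih =>
    rw [pow_succ, degreePart_mul, Finset.sum_eq_single ((j : ZMod p) * g)]
    · rw [ih, Nat.cast_succ, add_mul, add_sub_cancel_left, one_mul, hx]
    · intro h _ hne
      rw [← ih, degreePart_degreePart, if_neg hne, zero_mul]
    · simp

/-- The component of degree `g` on `sl_n`. -/
def slPart (g : ZMod p) : LieAlgebra.SpecialLinear.sl (Fin (m + 1)) k →ₗ[k]
    LieAlgebra.SpecialLinear.sl (Fin (m + 1)) k where
  toFun y := ⟨degreePart g y.1, trace_degreePart g y.1 y.2⟩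
  map_add' x y := Subtype.ext (map_add (degreePart g) x.1 y.1)
  map_smul' c x := Subtype.ext (map_smul (degreePart g) c x.1)

/-- The projection `x ↦ x - tr(x) E_{11}` of `gl_n` onto `sl_n`. -/
def slProj (k : Type u) [Field k] (m : ℕ) : Matrix (Fin (m + 1)) (Fin (m + 1)) k →ₗ[k]
    LieAlgebra.SpecialLinear.sl (Fin (m + 1)) k where
  toFun x := ⟨x - x.trace • toralElt k m, by
    change Matrix.trace (x - x.trace • toralElt k m) = 0
    rw [Matrix.trace_sub, Matrix.trace_smul, trace_toralElt, smul_eq_mul, mul_one, sub_self]⟩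
  map_add' x y := Subtype.ext (by
    change x + y - (x + y).trace • toralElt k m =
      (x - x.trace • toralElt k m) + (y - y.trace • toralElt k m)
    rw [Matrix.trace_add, add_smul]
    abel)
  map_smul' c x := Subtype.ext (by
    change c • x - (c • x).trace • toralElt k m = c • (x - x.trace • toralElt k m)
    rw [Matrix.trace_smul, smul_sub, smul_assoc])

theorem slProj_val (y : LieAlgebra.SpecialLinear.sl (Fin (m + 1)) k) : slProj k m y.1 = y := by
  have hy : y.1.trace = 0 := y.2
  refine Subtype.ext ?_
  change y.1 - y.1.trace • toralElt k m = y.1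
  rw [hy, zero_smul, sub_zero]

theorem slProj_add_smul (x : Matrix (Fin (m + 1)) (Fin (m + 1)) k) :
    x = (slProj k m x).1 + x.trace • toralElt k m :=
  (sub_add_cancel _ _).symm

theorem sum_slPart (y : LieAlgebra.SpecialLinear.sl (Fin (m + 1)) k) :
    ∑ g : ZMod p, slPart g y = y := by
  refine Subtype.ext ?_
  have := map_sum (LieAlgebra.SpecialLinear.sl (Fin (m + 1)) k).toSubmodule.subtype
    (fun g : ZMod p => slPart g y) Finset.univ
  exact this.trans (sum_degreePart y.1)

variable {N : Type v} [AddCommGroup N] [Module k N]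

/-- The operator `(φ ↦ (j ↦ T (φ (j - g))))`. -/
def shiftOp (g : ZMod p) : Module.End k N →ₗ[k] Module.End k (ZMod p → N) where
  toFun T :=
    { toFun := fun φ j => T (φ (j - g))
      map_add' := fun _ _ => funext fun _ => map_add T _ _
      map_smul' := fun _ _ => funext fun _ => map_smul T _ _ }
  map_add' _ _ := rfl
  map_smul' _ _ := rfl

theorem shiftOp_apply (g : ZMod p) (T : Module.End k N) (φ : ZMod p → N) (j : ZMod p) :
    shiftOp g T φ j = T (φ (j - g)) := rfl

theorem shiftOp_mul (g h : ZMod p) (T U : Module.End k N) :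
    shiftOp g T * shiftOp h U = shiftOp (g + h) (T * U) := by
  refine LinearMap.ext fun φ => funext fun j => ?_
  simp only [Module.End.mul_apply, shiftOp_apply, sub_sub]

theorem shiftOp_pow (g : ZMod p) (T : Module.End k N) (j : ℕ) :
    shiftOp g T ^ j = shiftOp ((j : ZMod p) * g) (T ^ j) := by
  induction j with
  | zero =>
    refine LinearMap.ext fun φ => funext fun i => ?_
    rw [shiftOp_apply]
    simp
  | succ j ih => rw [pow_succ, ih, shiftOp_mul, pow_succ, Nat.cast_succ, add_mul, one_mul]

/-- The operator `(φ ↦ (j ↦ (μ + j) • φ j))`. -/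
def diagOp (p : ℕ) [CharP k p] (N : Type v) [AddCommGroup N] [Module k N] (μ : k) :
    Module.End k (ZMod p → N) where
  toFun φ j := (μ + primeCast k p j) • φ j
  map_add' _ _ := funext fun _ => smul_add _ _ _
  map_smul' _ _ := funext fun _ => smul_comm _ _ _

theorem diagOp_apply (μ : k) (φ : ZMod p → N) (j : ZMod p) :
    diagOp p N μ φ j = (μ + primeCast k p j) • φ j := rfl

theorem diagOp_lie_shiftOp (μ : k) (g : ZMod p) (T : Module.End k N) :
    diagOp p N μ * shiftOp g T - shiftOp g T * diagOp p N μ = primeCast k p g • shiftOp g T := by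
  refine LinearMap.ext fun φ => funext fun j => ?_
  rw [LinearMap.sub_apply, Pi.sub_apply, Module.End.mul_apply, Module.End.mul_apply, diagOp_apply,
    shiftOp_apply, shiftOp_apply, diagOp_apply, map_smul, ← sub_smul, map_sub]
  rw [LinearMap.smul_apply, Pi.smul_apply, shiftOp_apply]
  congr 1
  ring

theorem diagOp_pow_char {μ c : k} (hμ : μ ^ p = μ + c) :
    diagOp p N μ ^ p = diagOp p N μ + algebraMap k _ c := by
  have h : ∀ (i : ℕ) (φ : ZMod p → N) j,
      (diagOp p N μ ^ i) φ j = (μ + primeCast k p j) ^ i • φ j := by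
    intro i
    induction i with
    | zero => simp
    | succ i ih =>
      intro φ j
      rw [pow_succ', Module.End.mul_apply, diagOp_apply, ih, smul_smul, ← pow_succ']
  refine LinearMap.ext fun φ => funext fun j => ?_
  rw [h, add_pow_char, hμ, primeCast_pow_char, LinearMap.add_apply, Pi.add_apply, diagOp_apply,
    Module.algebraMap_end_apply, Pi.smul_apply, ← add_smul]
  congr 1
  ring

/-- The action of `sl_n` on `ZMod p → N`. -/
noncomputable def coindSl (β : LieAlgebra.SpecialLinear.sl (Fin (m + 1)) k →ₗ⁅k⁆ Module.End k N) :
    LieAlgebra.SpecialLinear.sl (Fin (m + 1)) k →ₗ[k] Module.End k (ZMod p → N) :=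
  ∑ g : ZMod p, shiftOp g ∘ₗ (β : _ →ₗ[k] _) ∘ₗ slPart g

variable (β : LieAlgebra.SpecialLinear.sl (Fin (m + 1)) k →ₗ⁅k⁆ Module.End k N)

theorem coindSl_apply (y : LieAlgebra.SpecialLinear.sl (Fin (m + 1)) k) :
    coindSl (p := p) β y = ∑ g : ZMod p, shiftOp g (β (slPart g y)) := by
  simp [coindSl]

/-- Shifts compose additively and the bracket of sl_n respects degrees, so both sides are the same
double sum after the substitution (l, g) ↦ (g, l - g). -/
theorem coindSl_lie (y z : LieAlgebra.SpecialLinear.sl (Fin (m + 1)) k) :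
    coindSl (p := p) β ⁅y, z⁆ =
      coindSl β y * coindSl β z - coindSl β z * coindSl β y := by
  have h1 : ∀ l : ZMod p, slPart l ⁅y, z⁆ = ∑ g : ZMod p, ⁅slPart g y, slPart (l - g) z⁆ := by
    intro l
    refine Subtype.ext ?_
    have := map_sum (LieAlgebra.SpecialLinear.sl (Fin (m + 1)) k).toSubmodule.subtype
      (fun g : ZMod p => ⁅slPart g y, slPart (l - g) z⁆) Finset.univ
    exact (degreePart_lie l y.1 z.1).trans this.symm
  have h2 : ∀ l g : ZMod p, shiftOp l (β ⁅slPart g y, slPart (l - g) z⁆) =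
      shiftOp g (β (slPart g y)) * shiftOp (l - g) (β (slPart (l - g) z)) -
        shiftOp (l - g) (β (slPart (l - g) z)) * shiftOp g (β (slPart g y)) := by
    intro l g
    rw [shiftOp_mul, shiftOp_mul, add_sub_cancel, sub_add_cancel, ← map_sub, LieHom.map_lie]
    rfl
  simp only [coindSl_apply, h1, map_sum, h2]
  have h3 : ∀ F : ZMod p → ZMod p → Module.End k (ZMod p → N),
      ∑ l : ZMod p, ∑ g : ZMod p, F g (l - g) = ∑ g : ZMod p, ∑ h : ZMod p, F g h := by
    intro F
    rw [Finset.sum_comm]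
    exact Finset.sum_congr rfl fun g _ => Fintype.sum_equiv (Equiv.subRight g) _ _ fun l => rfl
  rw [h3 fun g h => shiftOp g (β (slPart g y)) * shiftOp h (β (slPart h z)) -
    shiftOp h (β (slPart h z)) * shiftOp g (β (slPart g y))]
  simp only [Finset.sum_sub_distrib]
  rw [Finset.sum_mul_sum, Finset.sum_mul_sum]
  congr 1
  exact Finset.sum_comm

/-- The degree g part of [E, y] is g times that of y, and a shift by g raises the weight of `diagOp`
by g. -/
theorem coindSl_toralElt_lie (μ : k) (y : LieAlgebra.SpecialLinear.sl (Fin (m + 1)) k) :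
    coindSl (p := p) β ⟨⁅toralElt k m, y.1⁆, lie_mem_sl _ _⟩ =
      diagOp p N μ * coindSl β y - coindSl β y * diagOp p N μ := by
  rw [coindSl_apply, coindSl_apply, Finset.mul_sum, Finset.sum_mul, ← Finset.sum_sub_distrib]
  refine Finset.sum_congr rfl fun g _ => ?_
  rw [diagOp_lie_shiftOp, ← map_smul, ← map_smul]
  congr 2
  exact Subtype.ext (degreePart_toralElt_lie g y.1)

/-- The action of `gl_n` on `ZMod p → N`. -/
noncomputable def coindGl (μ : k) :
    Matrix (Fin (m + 1)) (Fin (m + 1)) k →ₗ⁅k⁆ Module.End k (ZMod p → N) :=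
  { coindSl β ∘ₗ slProj k m +
      (Matrix.traceLinearMap (Fin (m + 1)) k k).smulRight (diagOp p N μ) with
    map_lie' := by
      intro x y
      change coindSl β (slProj k m ⁅x, y⁆) + Matrix.trace ⁅x, y⁆ • diagOp p N μ =
        ⁅coindSl β (slProj k m x) + x.trace • diagOp p N μ,
          coindSl β (slProj k m y) + y.trace • diagOp p N μ⁆
      have h0 : Matrix.trace ⁅x, y⁆ = 0 := lie_mem_sl x y
      have h1 : slProj k m ⁅x, y⁆ = ⁅slProj k m x, slProj k m y⁆ +
          x.trace • (⟨⁅toralElt k m, (slProj k m y).1⁆, lie_mem_sl _ _⟩ :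
            LieAlgebra.SpecialLinear.sl (Fin (m + 1)) k) -
          y.trace • (⟨⁅toralElt k m, (slProj k m x).1⁆, lie_mem_sl _ _⟩ :
            LieAlgebra.SpecialLinear.sl (Fin (m + 1)) k) := by
        refine Subtype.ext ?_
        change ⁅x, y⁆ - Matrix.trace ⁅x, y⁆ • toralElt k m =
          ⁅(slProj k m x).1, (slProj k m y).1⁆ + x.trace • ⁅toralElt k m, (slProj k m y).1⁆ -
            y.trace • ⁅toralElt k m, (slProj k m x).1⁆
        rw [h0, zero_smul, sub_zero]
        conv_lhs => rw [slProj_add_smul x, slProj_add_smul y]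
        rw [add_lie, lie_add, lie_add, smul_lie, smul_lie, lie_smul, lie_smul, lie_self,
          ← lie_skew (toralElt k m) (slProj k m x).1]
        simp only [smul_neg, smul_zero]
        abel
      rw [h0, zero_smul, add_zero, h1, map_sub, map_add, map_smul, map_smul, coindSl_lie,
        coindSl_toralElt_lie β μ, coindSl_toralElt_lie β μ, LieRing.of_associative_ring_bracket]
      simp only [add_mul, mul_add, smul_sub, smul_add, smul_mul_assoc, mul_smul_comm]
      rw [smul_comm x.trace y.trace]
      abel }

theorem coindGl_apply (μ : k) (x : Matrix (Fin (m + 1)) (Fin (m + 1)) k) :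
    coindGl (p := p) β μ x = coindSl β (slProj k m x) + x.trace • diagOp p N μ := rfl

theorem coindGl_val (μ : k) (y : LieAlgebra.SpecialLinear.sl (Fin (m + 1)) k) :
    coindGl (p := p) β μ y.1 = coindSl β y := by
  have hy : y.1.trace = 0 := y.2
  rw [coindGl_apply, slProj_val, hy, zero_smul, add_zero]

theorem coindGl_toralElt (μ : k) : coindGl (p := p) β μ (toralElt k m) = diagOp p N μ := by
  have h : slProj k m (toralElt k m) = 0 := by
    refine Subtype.ext ?_
    change toralElt k m - (toralElt k m).trace • toralElt k m = 0
    rw [trace_toralElt, one_smul, sub_self]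
  rw [coindGl_apply, h, map_zero, zero_add, trace_toralElt, one_smul]

theorem coindSl_of_slPart_eq {g : ZMod p} {y : LieAlgebra.SpecialLinear.sl (Fin (m + 1)) k}
    (hy : slPart g y = y) : coindSl (p := p) β y = shiftOp g (β y) := by
  have hv : degreePart g y.1 = y.1 := congr_arg Subtype.val hy
  rw [coindSl_apply, Finset.sum_eq_single g]
  · rw [hy]
  · intro h _ hne
    have : slPart h y = 0 := by
      refine Subtype.ext ?_
      change degreePart h y.1 = 0
      rw [← hv, degreePart_degreePart, if_neg hne]
    rw [this, map_zero, map_zero]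
  · simp

/-- For a Lie algebra map `f`, the condition `f x ^ p = f (x ^ p) + χ x ^ p` is additive in `x`. -/
theorem pow_char_condition_add {A B : Type*} [Ring A] [Algebra k A] [Ring B] [Algebra k B]
    (f : A →ₗ⁅k⁆ B) (χ : Module.Dual k A) {x y : A}
    (hx : f x ^ p = f (x ^ p) + algebraMap k B (χ x ^ p))
    (hy : f y ^ p = f (y ^ p) + algebraMap k B (χ y ^ p)) :
    f (x + y) ^ p = f ((x + y) ^ p) + algebraMap k B (χ (x + y) ^ p) := by
  -- The graph of a Lie map is closed under commutators in A × B, so it contains the Jacobson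
  -- correction term of (x, f x) and (y, f y).
  have h := add_pow_char_sub_mem (p := p) (LinearMap.graph (f : A →ₗ[k] B)) (by
    rintro ⟨a, a'⟩ ha ⟨b, b'⟩ hb
    rw [LinearMap.mem_graph_iff] at ha hb ⊢
    change a' = f a at ha
    change b' = f b at hb
    change a' * b' - b' * a' = f (a * b - b * a)
    rw [ha, hb]
    exact (f.map_lie a b).symm) (x := (x, f x)) (y := (y, f y)) rfl rfl
  rw [LinearMap.mem_graph_iff] at h
  change (f x + f y) ^ p - f x ^ p - f y ^ p = f ((x + y) ^ p - x ^ p - y ^ p) at h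
  rw [map_sub, map_sub, hx, hy] at h
  rw [map_add f, map_add χ, add_pow_char, map_add]
  rw [eq_add_of_sub_eq (eq_add_of_sub_eq h)]
  abel

/-- By additivity it suffices to treat homogeneous elements of sl_n and multiples of E. For degree
g, the p-th power of the shift by g is the shift by p g = 0, so the condition is inherited from N;
for E it is the equation for μ. -/
theorem coindGl_pow_char (χ : Module.Dual k (Matrix (Fin (m + 1)) (Fin (m + 1)) k))
    (hβ : ∀ y, β y ^ p = β (slPow p (m + 1) y) + algebraMap k _ (χ y.1 ^ p)) {μ : k}
    (hμ : μ ^ p = μ + χ (toralElt k m) ^ p) (x : Matrix (Fin (m + 1)) (Fin (m + 1)) k) :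
    coindGl (p := p) β μ x ^ p = coindGl β μ (x ^ p) + algebraMap k _ (χ x ^ p) := by
  have hp := (Fact.out : p.Prime)
  have hpart : ∀ (y : LieAlgebra.SpecialLinear.sl (Fin (m + 1)) k) (g : ZMod p),
      coindGl (p := p) β μ (slPart g y).1 ^ p =
        coindGl β μ ((slPart g y).1 ^ p) + algebraMap k _ (χ (slPart g y).1 ^ p) := by
    intro y g
    have h1 : degreePart g (slPart g y).1 = (slPart g y).1 := by
      change degreePart g (degreePart g y.1) = degreePart g y.1
      rw [degreePart_degreePart, if_pos rfl]
    have h2 : slPart g (slPart g y) = slPart g y := Subtype.ext h1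
    have h3 : slPart (0 : ZMod p) (slPow p (m + 1) (slPart g y)) = slPow p (m + 1) (slPart g y) := by
      have := degreePart_pow_of_eq h1 p
      rw [CharP.cast_eq_zero, zero_mul] at this
      exact Subtype.ext this
    rw [coindGl_val, coindSl_of_slPart_eq β h2, shiftOp_pow, hβ, CharP.cast_eq_zero, zero_mul,
      map_add]
    congr 1
    · exact (coindSl_of_slPart_eq β h3).symm.trans (coindGl_val β μ _).symm
    · refine LinearMap.ext fun φ => funext fun j => ?_
      rw [shiftOp_apply, sub_zero, Module.algebraMap_end_apply, Module.algebraMap_end_apply,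
        Pi.smul_apply]
  have hsl : ∀ s : Finset (ZMod p), ∀ y : LieAlgebra.SpecialLinear.sl (Fin (m + 1)) k,
      coindGl (p := p) β μ (∑ g ∈ s, (slPart g y).1) ^ p =
        coindGl β μ ((∑ g ∈ s, (slPart g y).1) ^ p) +
          algebraMap k _ (χ (∑ g ∈ s, (slPart g y).1) ^ p) := by
    intro s y
    induction s using Finset.induction_on with
    | empty => simp [zero_pow hp.ne_zero]
    | insert a s ha ih =>
      rw [Finset.sum_insert ha]
      exact pow_char_condition_add _ χ (hpart y a) ih
  have hE : ∀ c : k, coindGl (p := p) β μ (c • toralElt k m) ^ p =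
      coindGl β μ ((c • toralElt k m) ^ p) + algebraMap k _ (χ (c • toralElt k m) ^ p) := by
    intro c
    rw [smul_pow, toralElt_pow_char, map_smul, map_smul, coindGl_toralElt, smul_pow,
      diagOp_pow_char hμ, smul_add, map_smul, smul_eq_mul, mul_pow, map_mul, Algebra.smul_def,
      Algebra.smul_def (c ^ p) (algebraMap k _ _)]
  have h := hsl Finset.univ (slProj k m x)
  have hs : ∑ g : ZMod p, (slPart g (slProj k m x)).1 = (slProj k m x).1 :=
    sum_degreePart _
  rw [hs] at h
  have := pow_char_condition_add _ χ h (hE x.trace)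
  rwa [← slProj_add_smul] at this

end Coinduction

/-! ### Weight projections and splitting of surjections onto restricted projectives. -/

section Projectivity

set_option linter.unusedSectionVars false

variable {k : Type u} [Field k] {p : ℕ} [Fact p.Prime] [CharP k p] {m : ℕ}

theorem toralElt_lie_degreePart (g : ZMod p) (x : Matrix (Fin (m + 1)) (Fin (m + 1)) k) :
    ⁅toralElt k m, degreePart g x⁆ = primeCast k p g • degreePart g x := by
  ext a b
  rw [LieRing.of_associative_ring_bracket, toralElt, Matrix.sub_apply, Matrix.diagonal_mul,
    Matrix.mul_diagonal, Matrix.smul_apply, degreePart_apply]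
  split_ifs with h
  · rw [← h, map_sub, primeCast_toralWeight, primeCast_toralWeight, smul_eq_mul]
    ring
  · simp

variable (χ : Module.Dual k (Matrix (Fin (m + 1)) (Fin (m + 1)) k))

/-- The action of `sl_n` on a `U_χ(sl_n)`-module. -/
noncomputable def slAction (N : Type v) [AddCommGroup N] [Module k N]
    [Module (USl p (m + 1) (resChar (m + 1) χ)) N]
    [IsScalarTower k (USl p (m + 1) (resChar (m + 1) χ)) N] :
    LieAlgebra.SpecialLinear.sl (Fin (m + 1)) k →ₗ⁅k⁆ Module.End k N :=
  have : SMulCommClass k (USl p (m + 1) (resChar (m + 1) χ)) N := IsScalarTower.to_smulCommClass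
  ((Algebra.lsmul k k N : USl p (m + 1) (resChar (m + 1) χ) →ₐ[k] Module.End k N) :
    USl p (m + 1) (resChar (m + 1) χ) →ₗ⁅k⁆ Module.End k N).comp (slι p χ)

/-- The module coinduced from `U_χ(sl_n)` to `U_χ(gl_n)`, as functions `ZMod p → N`. -/
def Coind (p : ℕ) (N : Type v) : Type v := ZMod p → N

instance (N : Type v) [AddCommGroup N] : AddCommGroup (Coind p N) :=
  inferInstanceAs (AddCommGroup (ZMod p → N))

/-- Elements of the coinduced module as functions. -/
def coindEquiv (p : ℕ) (N : Type v) [AddCommGroup N] : Coind p N ≃+ (ZMod p → N) :=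
  AddEquiv.refl (ZMod p → N)

variable {N : Type v} [AddCommGroup N] [Module k N]
  [Module (USl p (m + 1) (resChar (m + 1) χ)) N]
  [IsScalarTower k (USl p (m + 1) (resChar (m + 1) χ)) N] {μ : k}
  (hμ : μ ^ p = μ + χ (toralElt k m) ^ p)

theorem slAction_pow_char (y : LieAlgebra.SpecialLinear.sl (Fin (m + 1)) k) :
    slAction (p := p) χ N y ^ p =
      slAction χ N (slPow p (m + 1) y) + algebraMap k _ (χ y.1 ^ p) := by
  have : SMulCommClass k (USl p (m + 1) (resChar (m + 1) χ)) N := IsScalarTower.to_smulCommClass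
  have h := ReducedEnvelopingAlgebra.ι_pow p (slPow p (m + 1)) (resChar (m + 1) χ) y
  have h2 := congr_arg (Algebra.lsmul k k N :
    USl p (m + 1) (resChar (m + 1) χ) →ₐ[k] Module.End k N) h
  rw [map_pow, map_add, AlgHom.commutes] at h2
  exact h2

/-- The action of `U_χ(gl_n)` on the coinduced module. -/
noncomputable def coindHom : UGl p (m + 1) χ →ₐ[k] Module.End k (ZMod p → N) :=
  ReducedEnvelopingAlgebra.lift p _ χ (coindGl (slAction (p := p) χ N) μ)
    (coindGl_pow_char _ χ (slAction_pow_char χ) hμ)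

/-- The `U_χ(gl_n)`-module structure of the coinduced module. -/
noncomputable abbrev coindModule : Module (UGl p (m + 1) χ) (Coind p N) :=
  Module.compHom (R := Module.End k (ZMod p → N)) (ZMod p → N)
    (coindHom χ hμ : UGl p (m + 1) χ →ₐ[k] Module.End k (ZMod p → N)).toRingHom

theorem coindHom_algebraMap (c : k) (φ : ZMod p → N) (j : ZMod p) :
    coindHom χ hμ (algebraMap k _ c) φ j = c • φ j := by
  rw [AlgHom.commutes]
  rfl

theorem coindHom_toralElt (φ : ZMod p → N) (j : ZMod p) :
    coindHom χ hμ (glι p χ (toralElt k m)) φ j = (μ + primeCast k p j) • φ j := by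
  rw [coindHom, ReducedEnvelopingAlgebra.lift_ι, coindGl_toralElt, diagOp_apply]

theorem coindHom_sl (y : LieAlgebra.SpecialLinear.sl (Fin (m + 1)) k) (φ : ZMod p → N)
    (j : ZMod p) : coindHom χ hμ (glι p χ y.1) φ j =
      ∑ g : ZMod p, slι p χ (slPart g y) • φ (j - g) := by
  rw [coindHom, ReducedEnvelopingAlgebra.lift_ι, coindGl_val, coindSl_apply, LinearMap.sum_apply,
    Finset.sum_apply]
  rfl

/-- Summing over j hides the shifts, so the homogeneous parts of y recombine to y. Summation is the
counit of the adjunction between restriction and coinduction. -/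
theorem sum_coindHom_slToGl (b : USl p (m + 1) (resChar (m + 1) χ)) (φ : ZMod p → N) :
    ∑ j : ZMod p, coindHom χ hμ (slToGl p (m + 1) χ b) φ j = b • ∑ j : ZMod p, φ j := by
  induction b using ReducedEnvelopingAlgebra.induction_on generalizing φ with
  | hι y =>
    rw [slToGl_ι]
    simp only [coindHom_sl]
    rw [Finset.sum_comm]
    have : ∀ g : ZMod p, ∑ j : ZMod p, slι p χ (slPart g y) • φ (j - g) =
        slι p χ (slPart g y) • ∑ j : ZMod p, φ j := by
      intro g
      rw [Finset.smul_sum]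
      exact Fintype.sum_equiv (Equiv.subRight g) _ _ fun j => rfl
    simp only [this]
    rw [← Finset.sum_smul]
    have h := congr_arg (slι p χ).toLinearMap (sum_slPart (p := p) y)
    rw [map_sum] at h
    exact congr_arg (· • ∑ j : ZMod p, φ j) h
  | hs c =>
    rw [AlgHom.commutes]
    simp only [coindHom_algebraMap]
    rw [← Finset.smul_sum, algebraMap_smul]
  | hadd a b ha hb =>
    simp only [map_add, LinearMap.add_apply, Pi.add_apply]
    rw [Finset.sum_add_distrib, ha, hb, add_smul]
  | hmul a b ha hb =>
    simp only [map_mul, Module.End.mul_apply]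
    rw [ha, hb, mul_smul]

section WeightProjection

variable {P : Type w} [AddCommGroup P] [Module k P] [Module (UGl p (m + 1) χ) P]
  [IsScalarTower k (UGl p (m + 1) χ) P]

/-- The action of `gl_n` on a `U_χ(gl_n)`-module. -/
noncomputable def glAction (P : Type w) [AddCommGroup P] [Module k P]
    [Module (UGl p (m + 1) χ) P] [IsScalarTower k (UGl p (m + 1) χ) P] :
    UGl p (m + 1) χ →ₐ[k] Module.End k P :=
  have : SMulCommClass k (UGl p (m + 1) χ) P := IsScalarTower.to_smulCommClass
  Algebra.lsmul k k P

theorem glAction_apply (a : UGl p (m + 1) χ) (x : P) : glAction χ P a x = a • x := rfl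

/-- `E_{11} - μ - j` acting on a `U_χ(gl_n)`-module. -/
noncomputable def shiftedToral (P : Type w) [AddCommGroup P] [Module k P]
    [Module (UGl p (m + 1) χ) P] [IsScalarTower k (UGl p (m + 1) χ) P] (μ : k) (j : ZMod p) :
    Module.End k P :=
  glAction χ P (glι p χ (toralElt k m)) - algebraMap k _ μ - algebraMap k _ (primeCast k p j)

/-- The projection onto the weight space of weight `μ + j`. -/
noncomputable def weightProj (P : Type w) [AddCommGroup P] [Module k P]
    [Module (UGl p (m + 1) χ) P] [IsScalarTower k (UGl p (m + 1) χ) P] (μ : k) (j : ZMod p) :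
    Module.End k P :=
  1 - shiftedToral χ P μ j ^ (p - 1)

theorem sum_weightProj : ∑ j : ZMod p, weightProj χ P μ j = 1 := by
  have h0 : (p : Module.End k P) = 0 := by
    rw [← map_natCast (algebraMap k (Module.End k P)), CharP.cast_eq_zero, map_zero]
  simp only [weightProj, shiftedToral]
  rw [Finset.sum_sub_distrib, sum_sub_pow_char_sub_one, Finset.sum_const, Finset.card_univ,
    ZMod.card, nsmul_one, h0, sub_neg_eq_add, zero_add]

include hμ in
theorem shiftedToral_pow_char (j : ZMod p) :
    shiftedToral χ P μ j ^ p = shiftedToral χ P μ j := by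
  rcases subsingleton_or_nontrivial P with h | h
  · exact LinearMap.ext fun x => Subsingleton.elim _ _
  have : CharP (Module.End k P) p := charP_of_injective_algebraMap
        (FaithfulSMul.algebraMap_injective k (Module.End k P)) p
  rw [shiftedToral, sub_pow_char_of_commute p (Algebra.commute_algebraMap_right _ _),
    sub_pow_char_of_commute p (Algebra.commute_algebraMap_right _ _), ← map_pow (glAction χ P),
    ← map_pow (algebraMap k (Module.End k P)), ← map_pow (algebraMap k (Module.End k P)), hμ, primeCast_pow_char, ReducedEnvelopingAlgebra.ι_pow, toralElt_pow_char, map_add,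
    map_add, AlgHom.commutes]
  abel

include hμ in
theorem toralElt_smul_weightProj (j : ZMod p) (x : P) :
    glι p χ (toralElt k m) • weightProj χ P μ j x = (μ + primeCast k p j) • weightProj χ P μ j x := by
  have h : shiftedToral χ P μ j * weightProj χ P μ j = 0 := by
    rw [weightProj, mul_sub, mul_one, ← pow_succ',
      Nat.sub_add_cancel (Fact.out : p.Prime).one_lt.le, shiftedToral_pow_char χ hμ, sub_self]
  have h2 := LinearMap.congr_fun h x
  rw [Module.End.mul_apply] at h2
  generalize weightProj χ P μ j x = z at h2
  rw [shiftedToral, LinearMap.sub_apply, LinearMap.sub_apply, glAction_apply,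
    Module.algebraMap_end_apply, Module.algebraMap_end_apply, sub_sub, ← add_smul,
    LinearMap.zero_apply, sub_eq_zero] at h2
  exact h2

theorem weightProj_toralElt_smul (j : ZMod p) (x : P) :
    weightProj χ P μ j (glι p χ (toralElt k m) • x) =
      glι p χ (toralElt k m) • weightProj χ P μ j x := by
  have h : Commute (weightProj χ P μ j) (glAction χ P (glι p χ (toralElt k m))) := by
    refine (Commute.one_left _).sub_left (Commute.pow_left ?_ _)
    exact ((Commute.refl _).sub_left (Algebra.commute_algebraMap_left _ _)).sub_left
      (Algebra.commute_algebraMap_left _ _)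
  exact LinearMap.congr_fun h.eq x

/-- An element of degree g intertwines E - μ - (j - g) with E - μ - j, hence also the projections,
which are polynomials in these operators. -/
theorem weightProj_slPart_smul (g j : ZMod p)
    (y : LieAlgebra.SpecialLinear.sl (Fin (m + 1)) k) (x : P) :
    weightProj χ P μ j (glι p χ (slPart g y).1 • x) =
      glι p χ (slPart g y).1 • weightProj χ P μ (j - g) x := by
  set X := glAction χ P (glι p χ (slPart g y).1) with hX
  set D := glAction χ P (glι p χ (toralElt k m)) with hD
  have h1 : D * X = X * D + primeCast k p g • X := by
    rw [← sub_eq_iff_eq_add', hX, hD, ← map_mul (glAction χ P),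
      ← map_mul (glAction χ P), ← map_sub (glAction χ P), ← map_smul (glAction χ P),
      ← map_smul (glι p χ)]
    congr 1
    rw [← LieRing.of_associative_ring_bracket, ← LieHom.map_lie]
    congr 1
    exact toralElt_lie_degreePart g y.1
  have h2 : SemiconjBy X (shiftedToral χ P μ (j - g)) (shiftedToral χ P μ j) := by
    rw [SemiconjBy, shiftedToral, shiftedToral, ← hD, sub_mul, sub_mul, h1, mul_sub, mul_sub,
      map_sub, map_sub, mul_sub, ← Algebra.commutes μ X, ← Algebra.commutes (primeCast k p j) X,
      ← Algebra.commutes (primeCast k p g) X, Algebra.smul_def]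
    abel
  have h3 : SemiconjBy X (weightProj χ P μ (j - g)) (weightProj χ P μ j) :=
    (SemiconjBy.one_right X).sub_right (h2.pow_right _)
  exact (LinearMap.congr_fun h3.eq x).symm

theorem weightProj_sl_smul (j : ZMod p) (y : LieAlgebra.SpecialLinear.sl (Fin (m + 1)) k) (x : P) :
    weightProj χ P μ j (glι p χ y.1 • x) =
      ∑ g : ZMod p, glι p χ (slPart g y).1 • weightProj χ P μ (j - g) x := by
  have h : glι p χ y.1 = ∑ g : ZMod p, glι p χ (slPart g y).1 := by
    have := congr_arg (glι p χ).toLinearMap (sum_degreePart (p := p) y.1)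
    rw [map_sum] at this
    exact this.symm
  rw [h, Finset.sum_smul, map_sum]
  exact Finset.sum_congr rfl fun g _ => weightProj_slPart_smul χ g j y x

end WeightProjection

variable {P : Type w} [AddCommGroup P] [Module k P] [Module (UGl p (m + 1) χ) P]
  [IsScalarTower k (UGl p (m + 1) χ) P]
  [Module (USl p (m + 1) (resChar (m + 1) χ)) P]
  [IsScalarTower k (USl p (m + 1) (resChar (m + 1) χ)) P]

theorem exists_toral_decomposition (x : Matrix (Fin (m + 1)) (Fin (m + 1)) k) :
    ∃ (c : k) (y : LieAlgebra.SpecialLinear.sl (Fin (m + 1)) k), x = y.1 + c • toralElt k m :=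
  ⟨_, _, slProj_add_smul x⟩

include hμ in
-- The weight components give a gl_n-map F from P to its coinduced module. Projectivity lifts F
-- along the map induced by q, and summation over j turns the lift into an sl_n-map; composed with q
-- it is the sum of the weight projections, that is, the identity.
theorem exists_section_of_projective [Module.Projective (UGl p (m + 1) χ) P]
    (hP : ∀ (b : USl p (m + 1) (resChar (m + 1) χ)) (x : P), b • x = slToGl p (m + 1) χ b • x)
    (q : N →ₗ[USl p (m + 1) (resChar (m + 1) χ)] P) (hq : Function.Surjective q) :
    ∃ h : P →ₗ[USl p (m + 1) (resChar (m + 1) χ)] N, q ∘ₗ h = LinearMap.id := by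
  let _ : Module (UGl p (m + 1) χ) (Coind p N) := coindModule χ hμ
  let _ : Module (UGl p (m + 1) χ) (Coind p P) := coindModule χ hμ
  have hN : ∀ (a : UGl p (m + 1) χ) (φ : Coind p N),
      coindEquiv p N (a • φ) = coindHom χ hμ a (coindEquiv p N φ) := fun _ _ => rfl
  have hP' : ∀ (a : UGl p (m + 1) χ) (φ : Coind p P),
      coindEquiv p P (a • φ) = coindHom χ hμ a (coindEquiv p P φ) := fun _ _ => rfl
  have hqk : ∀ (c : k) (x : N), q (c • x) = c • q x := by
    intro c x
    rw [← algebraMap_smul (USl p (m + 1) (resChar (m + 1) χ)) c x, map_smul, algebraMap_smul]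
  let F₀ : P →+ Coind p P := (coindEquiv p P).symm.toAddMonoidHom.comp
    { toFun := fun x j => weightProj χ P μ j x
      map_zero' := funext fun _ => map_zero _
      map_add' := fun _ _ => funext fun _ => map_add _ _ _ }
  have hF₀ : ∀ x j, coindEquiv p P (F₀ x) j = weightProj χ P μ j x := fun _ _ => rfl
  let F : P →ₗ[UGl p (m + 1) χ] Coind p P :=
    { F₀ with
      map_smul' := map_smul_of_toral χ exists_toral_decomposition F₀
        (fun c x => (coindEquiv p P).injective <| funext fun j => by
          rw [hP', coindHom_algebraMap, hF₀, hF₀, algebraMap_smul, map_smul])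
        (fun y x => (coindEquiv p P).injective <| funext fun j => by
          rw [hP', coindHom_sl, hF₀, weightProj_sl_smul]
          refine Finset.sum_congr rfl fun g _ => ?_
          rw [hP, slToGl_ι, hF₀])
        (fun x => (coindEquiv p P).injective <| funext fun j => by
          rw [hP', coindHom_toralElt, hF₀, hF₀, weightProj_toralElt_smul,
            toralElt_smul_weightProj χ hμ]) }
  let q₀ : Coind p N →+ Coind p P := (coindEquiv p P).symm.toAddMonoidHom.comp
    { toFun := fun φ j => q (coindEquiv p N φ j)
      map_zero' := funext fun _ => map_zero q
      map_add' := fun _ _ => funext fun _ => map_add q _ _ }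
  have hq₀ : ∀ φ j, coindEquiv p P (q₀ φ) j = q (coindEquiv p N φ j) := fun _ _ => rfl
  let qs : Coind p N →ₗ[UGl p (m + 1) χ] Coind p P :=
    { q₀ with
      map_smul' := map_smul_of_toral χ exists_toral_decomposition q₀
        (fun c φ => (coindEquiv p P).injective <| funext fun j => by
          rw [hP', coindHom_algebraMap, hq₀, hq₀, hN, coindHom_algebraMap, hqk])
        (fun y φ => (coindEquiv p P).injective <| funext fun j => by
          rw [hP', coindHom_sl, hq₀, hN, coindHom_sl, map_sum]
          exact Finset.sum_congr rfl fun g _ => map_smul q _ _)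
        (fun φ => (coindEquiv p P).injective <| funext fun j => by
          rw [hP', coindHom_toralElt, hq₀, hq₀, hN, coindHom_toralElt, hqk]) }
  have hqs : Function.Surjective qs := fun φ =>
    ⟨(coindEquiv p N).symm fun j => (hq (coindEquiv p P φ j)).choose,
      (coindEquiv p P).injective <| funext fun j => (hq (coindEquiv p P φ j)).choose_spec⟩
  obtain ⟨H, hH⟩ := Module.projective_lifting_property qs F hqs
  refine ⟨{ toFun := fun x => ∑ j : ZMod p, coindEquiv p N (H x) j
            map_add' := fun x y => by
              simp only [map_add, Pi.add_apply, Finset.sum_add_distrib]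
            map_smul' := fun b x => by
              rw [hP, map_smul, hN, sum_coindHom_slToGl]
              rfl }, LinearMap.ext fun x => ?_⟩
  change q (∑ j : ZMod p, coindEquiv p N (H x) j) = x
  have h1 : ∀ j, q (coindEquiv p N (H x) j) = weightProj χ P μ j x := fun j =>
    congr_fun (LinearMap.congr_fun hH x) j
  rw [map_sum]
  simp only [h1]
  rw [← LinearMap.sum_apply, sum_weightProj, Module.End.one_apply]

end Projectivity

/-! ### Assembly of the three statements. -/

section MainResults

variable {k : Type u} [Field k] {p : ℕ} [Fact p.Prime] [CharP k p] {n : ℕ}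

theorem projective_res [IsAlgClosed k] (χ : Module.Dual k (Matrix (Fin n) (Fin n) k)) (P : Type v)
    [AddCommGroup P] [Module (UGl p n χ) P] [Module.Projective (UGl p n χ) P] :
    Module.Projective (USl p n (resChar n χ)) (Res n χ P) := by
  let _ : Module k (Res n χ P) :=
    Module.compHom (Res n χ P) (algebraMap k (USl p n (resChar n χ)))
  have hB : IsScalarTower k (USl p n (resChar n χ)) (Res n χ P) :=
    ⟨fun c b x => by rw [Algebra.smul_def, mul_smul]; rfl⟩
  let _ : Module (UGl p n χ) (Res n χ P) := inferInstanceAs (Module (UGl p n χ) P)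
  have hP : Module.Projective (UGl p n χ) (Res n χ P) :=
    inferInstanceAs (Module.Projective (UGl p n χ) P)
  have hres : ∀ (b : USl p n (resChar n χ)) (x : Res n χ P), b • x = slToGl p n χ b • x :=
    fun _ _ => rfl
  have hA : IsScalarTower k (UGl p n χ) (Res n χ P) := ⟨fun c a x => by
    have : ∀ z : Res n χ P, c • z = algebraMap k (UGl p n χ) c • z := by
      intro z
      rw [← AlgHom.commutes (slToGl p n χ) c, ← hres]
      rfl
    rw [Algebra.smul_def, mul_smul, this]⟩
  refine Module.Projective.of_lifting_property'' fun q hq => ?_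
  cases n with
  | zero =>
    -- There is no E_11 when n = 0, but then U_χ(sl_0) consists of scalars and any k-linear section
    -- is linear over it.
    have hsurj : Function.Surjective (algebraMap k (USl p 0 (resChar 0 χ))) := by
      intro b
      induction b using ReducedEnvelopingAlgebra.induction_on with
      | hι x => exact ⟨0, by rw [Subsingleton.elim x 0, map_zero, map_zero]⟩
      | hs c => exact ⟨c, rfl⟩
      | hadd a b ha hb =>
        obtain ⟨c, rfl⟩ := ha
        obtain ⟨d, rfl⟩ := hb
        exact ⟨c + d, map_add _ _ _⟩
      | hmul a b ha hb =>
        obtain ⟨c, rfl⟩ := ha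
        obtain ⟨d, rfl⟩ := hb
        exact ⟨c * d, map_mul _ _ _⟩
    obtain ⟨s, hs⟩ := Module.projective_lifting_property
      (q.restrictScalars k) (LinearMap.id : Res 0 χ P →ₗ[k] Res 0 χ P) hq
    refine ⟨{ s with map_smul' := fun b x => ?_ }, LinearMap.ext fun x => LinearMap.congr_fun hs x⟩
    obtain ⟨c, rfl⟩ := hsurj b
    change s (algebraMap k _ c • x) = algebraMap k _ c • s x
    rw [algebraMap_smul, algebraMap_smul, map_smul]
  | succ m =>
    -- An Artin–Schreier equation, solvable because k is algebraically closed.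
    obtain ⟨μ, hμ⟩ : ∃ μ : k, μ ^ p = μ + χ (toralElt k m) ^ p := by
      have hp := (Fact.out : p.Prime).one_lt
      let f : Polynomial k := Polynomial.X ^ p - (Polynomial.X + Polynomial.C (χ (toralElt k m) ^ p))
      have hdeg : f.degree = p := by
        refine (Polynomial.degree_sub_eq_left_of_degree_lt ?_).trans (Polynomial.degree_X_pow p)
        rw [Polynomial.degree_X_add_C, Polynomial.degree_X_pow]
        exact_mod_cast hp
      obtain ⟨μ, hμ⟩ := IsAlgClosed.exists_root f (by
        rw [hdeg]
        exact_mod_cast (by omega : p ≠ 0))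
      refine ⟨μ, ?_⟩
      simpa [f, Polynomial.IsRoot, sub_eq_zero] using hμ
    exact exists_section_of_projective χ hμ hres q hq

theorem isIndecomposable_res_of_projective [IsAlgClosed k]
    (χ : Module.Dual k (Matrix (Fin n) (Fin n) k)) (P : Type v)
    [AddCommGroup P] [Module (UGl p n χ) P] (hP : IsIndecomposable (UGl p n χ) P)
    [Module.Projective (UGl p n χ) P] :
    IsIndecomposable (USl p n (resChar n χ)) (Res n χ P) ∧
      IsNoetherian (USl p n (resChar n χ)) (Res n χ P) ∧
        IsArtinian (USl p n (resChar n χ)) (Res n χ P) := by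
  have hfin : Module.Finite k (UGl p n χ) :=
    ReducedEnvelopingAlgebra.finite p _ χ (Fact.out : p.Prime).two_le
  have : IsArtinianRing (UGl p n χ) := isArtinian_of_tower k inferInstance
  have hPf := hP.finite_of_projective
  let _ : Module k P := Module.compHom P (algebraMap k (UGl p n χ))
  have hA : IsScalarTower k (UGl p n χ) P :=
    ⟨fun c a x => by rw [Algebra.smul_def, mul_smul]; rfl⟩
  have hPk : Module.Finite k P := Module.Finite.trans (UGl p n χ) P
  let _ : Module k (Res n χ P) := Module.compHom P (algebraMap k (UGl p n χ))
  have hRk : Module.Finite k (Res n χ P) := hPk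
  have hB : IsScalarTower k (USl p n (resChar n χ)) (Res n χ P) :=
    ⟨fun c b x => by
      change slToGl p n χ (c • b) • (show P from x) =
        algebraMap k (UGl p n χ) c • slToGl p n χ b • (show P from x)
      rw [map_smul, Algebra.smul_def, mul_smul]⟩
  exact ⟨isIndecomposable_res χ P hP, isNoetherian_of_tower k inferInstance,
    isArtinian_of_tower k inferInstance⟩

end MainResults

theorem mainTheorem7 (k : Type u) [Field k] [IsAlgClosed k] (p : ℕ) [Fact p.Prime] [CharP k p]
    (n : ℕ) (χ : Module.Dual k (Matrix (Fin n) (Fin n) k)) :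
    (∀ (M : Type v) [AddCommGroup M] [Module k M] [Module (UGl p n χ) M]
        [IsScalarTower k (UGl p n χ) M] [Module.Finite k M],
      IsIndecomposable (UGl p n χ) M →
        IsIndecomposable (USl p n (resChar n χ)) (Res n χ M)) ∧
    (∀ (P : Type v) [AddCommGroup P] [Module (UGl p n χ) P],
      IsIndecomposable (UGl p n χ) P → Module.Projective (UGl p n χ) P →
        IsIndecomposable (USl p n (resChar n χ)) (Res n χ P) ∧
          Module.Projective (USl p n (resChar n χ)) (Res n χ P)) ∧
    (∀ (M : Type w) [AddCommGroup M] [Module (UGl p n χ) M] (P : Type v) [AddCommGroup P]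
        [Module (UGl p n χ) P] (π : P →ₗ[UGl p n χ] M),
      IsSimpleModule (UGl p n χ) M → IsProjectiveCover π →
        ∃ (E : Type v) (_ : AddCommGroup E) (_ : Module (USl p n (resChar n χ)) E)
          (ψ : Res n χ P →ₗ[USl p n (resChar n χ)] E),
          IsSimpleModule (USl p n (resChar n χ)) E ∧ IsProjectiveCover ψ) := by
  refine ⟨fun M _ _ _ _ _ hM => isIndecomposable_res χ M hM,
    fun P _ _ hP hproj => ⟨(isIndecomposable_res_of_projective χ P hP).1, projective_res χ P⟩,
    fun M _ _ P _ _ π hM hπ => ?_⟩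
  have := hπ.projective
  obtain ⟨hind, hnoeth, hart⟩ := isIndecomposable_res_of_projective χ P hπ.isIndecomposable
  have := projective_res χ P
  have := hind.1
  -- Any maximal submodule K of the restriction will do: the simple module E is the quotient by K.
  obtain ⟨K, hK, -⟩ := (eq_top_or_exists_le_coatom
    (⊥ : Submodule (USl p n (resChar n χ)) (Res n χ P))).resolve_left bot_ne_top
  exact ⟨Res n χ P ⧸ K, inferInstance, inferInstance, K.mkQ, isSimpleModule_iff_isCoatom.mpr hK,
    hind.isProjectiveCover_mkQ hK⟩
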